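/- Let $\Phi$ be the standard normal distribution function and $\Sigma_\rho=\begin{pmatrix}1&\rho\\ \rho&1\end{pmatrix}$. In the Gaussian mixture copula model with parameters $\varepsilon\in[0,1/2)$ and $\rho\in[0,1]$, a pair $(X,Y)$ satisfies $F(X)=\Phi(Z^1)$ and $G(Y)=\Phi(Z^2)$ almost surely, where $F,G$ are unknown continuous distribution functions on $\mathbb{R}$ and $(Z^1,Z^2)\sim(1-\varepsilon)\,\mathcal N(0,I)+\varepsilon\,\mathcal N(0,\Sigma_\rho)$. From an i.i.d. sample $(X_1,Y_1),\dots,(X_n,Y_n)$ one tests $\mathcal H_0:\varepsilon=0$ against $\mathcal H_1:\varepsilon=\varepsilon_n=n^{-\beta},\ \rho=\rho_n=1-n^{-\gamma}$, with $\beta,\gamma>0$ fixed. Let $R_i$ be the rank of $X_i$ among $X_1,\dots,X_n$, let $S_i$ be the rank of $Y_i$ among $Y_1,\dots,Y_n$, let $D_i=|R_i-S_i|$, and define $$\mathrm{HC}_{\mathrm{rank}}=\max_{t\in\mathbb{Z},\,0\le t\le n/2}\frac{\sum_{i=1}^n \mathbf 1\{D_i\le t\}-n\,u(t)}{\sqrt{n\,u(t)(1-u(t))}},\qquad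 u(t)=\frac{n(2t+1)-t(t+1)}{n^2},$$ where $u(t)$ is the probability of $\{D_i\le t\}$ under $\mathcal H_0$ (the quotient is read as $0$ when its denominator vanishes, which happens only for $n\le2$). Theorem. In the moderately sparse regime $1/2<\beta<3/4$, the higher criticism rank test, which rejects for large values of $\mathrm{HC}_{\mathrm{rank}}$, is asymptotically powerful whenever $\gamma>4(\beta-1/2)$. More precisely, there is a universal constant $C>0$ such that the following holds, where the functions $F,G$ are arbitrary, may vary with $n$, and may differ between the hypotheses. 1. Under $\mathcal H_0$, $\mathbb P_0(\mathrm{HC}_{\mathrm{rank}}\ge C\log n)\to0$. 2. If $1/2<\beta<3/4$ and $\gamma>4(\beta-1/2)$, then the test that rejects when $\mathrm{HC}_{\mathrm{rank}}\ge C\log n$ is asymptotically powerful: the sum of its probabilities of type I error (under $\mathcal H_0$) and of type II error (under $\mathcal H_1$) tends to $0$ as $n\to\infty$. 3. If $1/2<\beta<3/4$ and $\gamma>4(\beta-1/2)$, then under $\mathcal H_1$, for every $M\in\mathbb{R}$, $\mathbb P_1(\mathrm{HC}_{\mathrm{rank}}>M\log n)\to1$. -/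

import Mathlib

open MeasureTheory ProbabilityTheory Filter Topology

noncomputable section

namespace RankHC

/-- The standard normal distribution function `Φ`. -/
def stdNormalCDF (x : ℝ) : ℝ := cdf (gaussianReal 0 1) x

/-- The matrix `Σ_ρ`, with unit diagonal and off-diagonal entries `ρ`. -/
def corrMatrix (ρ : ℝ) : Matrix (Fin 2) (Fin 2) ℝ := !![1, ρ; ρ, 1]

/-- The Gaussian mixture `(1 - ε) N(0, I) + ε N(0, Σ_ρ)` on the plane, for `0 ≤ ε ≤ 1`. -/
def gaussianMixture (ε ρ : ℝ) : Measure (EuclideanSpace ℝ (Fin 2)) :=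
  ENNReal.ofReal (1 - ε) • multivariateGaussian 0 1
    + ENNReal.ofReal ε • multivariateGaussian 0 (corrMatrix ρ)

/-- `F` is a continuous (cumulative) distribution function on the real line. -/
structure IsContinuousDistributionFunction (F : ℝ → ℝ) : Prop where
  monotone : Monotone F
  continuous : Continuous F
  tendsto_atBot : Tendsto F atBot (𝓝 0)
  tendsto_atTop : Tendsto F atTop (𝓝 1)

/-- The Gaussian mixture copula model: `Q` is the law of a pair `(X, Y)` for which there is a
latent vector `(Z₁, Z₂) ∼ (1 - ε) N(0, I) + ε N(0, Σ_ρ)` with `F(X) = Φ(Z₁)` and `G(Y) = Φ(Z₂)`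
almost surely. The measure `π` is the joint law of `((X, Y), (Z₁, Z₂))`. -/
structure IsGaussianMixtureCopula (F G : ℝ → ℝ) (ε ρ : ℝ) (Q : Measure (ℝ × ℝ)) : Prop where
  distr_F : IsContinuousDistributionFunction F
  distr_G : IsContinuousDistributionFunction G
  weight_nonneg : 0 ≤ ε
  weight_lt : ε < 1 / 2
  corr_nonneg : 0 ≤ ρ
  corr_le : ρ ≤ 1
  exists_latent : ∃ π : Measure ((ℝ × ℝ) × EuclideanSpace ℝ (Fin 2)),
    π.map Prod.fst = Q ∧ π.map Prod.snd = gaussianMixture ε ρ ∧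
      ∀ᵐ p ∂π, F p.1.1 = stdNormalCDF (p.2 0) ∧ G p.1.2 = stdNormalCDF (p.2 1)

/-- The law of `n` independent draws from `Q`. -/
def sampleLaw (n : ℕ) (Q : Measure (ℝ × ℝ)) : Measure (Fin n → ℝ × ℝ) :=
  Measure.pi fun _ => Q

/-- The (increasing) rank of `x i` among `x 0, …, x (n - 1)`; ranks run from `1` to `n`. -/
def rank {n : ℕ} (x : Fin n → ℝ) (i : Fin n) : ℕ :=
  (Finset.univ.filter fun j => x j ≤ x i).card

/-- `D_i = |R_i - S_i|`, where `R_i` is the rank of `X_i` and `S_i` is the rank of `Y_i`. -/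
def rankDiff {n : ℕ} (s : Fin n → ℝ × ℝ) (i : Fin n) : ℕ :=
  ((rank (fun j => (s j).1) i : ℤ) - (rank (fun j => (s j).2) i : ℤ)).natAbs

/-- `u(t)`, the probability under the null that `D_i ≤ t`, in closed form. -/
def nullProb (n t : ℕ) : ℝ :=
  ((n : ℝ) * (2 * t + 1) - (t : ℝ) * (t + 1)) / (n : ℝ) ^ 2

/-- `(∑ᵢ 1{D_i ≤ t} - n u(t)) / √(n u(t) (1 - u(t)))`. -/
def standardizedCount {n : ℕ} (s : Fin n → ℝ × ℝ) (t : ℕ) : ℝ :=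
  (((Finset.univ.filter fun i => rankDiff s i ≤ t).card : ℝ) - n * nullProb n t)
    / √(n * nullProb n t * (1 - nullProb n t))

/-- The higher criticism rank statistic: the maximum over the integers `0 ≤ t ≤ n / 2`. -/
def hcRank {n : ℕ} (s : Fin n → ℝ × ℝ) : ℝ :=
  (Finset.range (n / 2 + 1)).sup' Finset.nonempty_range_add_one (standardizedCount s)

/-- A sequence of tests, with rejection regions `A n` for samples of size `n`, is asymptotically
powerful for the hypotheses `P₀ n` against `P₁ n` if the sum of its probabilities of type I and
type II errors tends to `0`. -/
def AsymptoticallyPowerful (P₀ P₁ : (n : ℕ) → Measure (Fin n → ℝ × ℝ))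
    (A : (n : ℕ) → Set (Fin n → ℝ × ℝ)) : Prop :=
  Tendsto (fun n => (P₀ n).real (A n) + (P₁ n).real (A n)ᶜ) atTop (𝓝 0)

end RankHC

end

/-! The ranks of the `X i` and `Y i` are almost surely those of the latent Gaussian coordinates,
because `F` and `G` are monotone and latent values are distinct. Hence the law of `hcRank` does not
depend on `F` and `G` (`map_hcRank_sampleLaw`), and everything is proved for i.i.d. latent pairs.

Under the null, given the first coordinates, permuting the second ones leaves their law unchanged.
The count of `D_i ≤ t` is then a statistic `∑ a(i, σ i)` of a uniform permutation, with a 0-1 matrix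
`a` and mean `μ = n u(t)`. Random transpositions form an exchangeable pair:
`sum_permStat_sub_mean_mul` turns `E (W - μ) g(W)` into an average over swaps, and swaps satisfy `∑
(W - W')² ≤ 4N (W + μ)`, where `N` is the size of the matrix. Taking `g` affine gives variance at
most `2μ`; taking `g` exponential gives a differential inequality for the moment generating function
and an exponential tail on the scale `√μ`. A union bound over `t` then shows that `24 log n` is
rarely reached.

Under the alternative one threshold `t = ⌊n^a⌋` suffices, with `max (1/2) (1 - γ/2) < a < 2 - 2β`;
such an `a` exists exactly because `β < 3/4` and `γ > 4(β - 1/2)`. About `n ε` observations are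
contaminated. Given such an observation, its rank difference is a sum of independent bounded terms
with mean of order `n |Φ(Z¹) - Φ(Z²)|`, so its second moment is at most `n + 2n²(1 - ρ)`, which is
`o(t²)` by the lower bounds on `a` (`real_contaminated_far_le`). Thus most contaminated observations
have `D_i ≤ t`. The clean ones contribute nearly `n u(t)`: permuting their second coordinates among
themselves gives a permutation statistic of a submatrix, whose fluctuations have order `√t`
(`real_cleanCount_le`). The excess is therefore at least `n ε / 4`, against a standard deviation of
order `n^(a/2)`, and `a < 2 - 2β` makes the ratio a positive power of `n`, which beats `log n`. -/

noncomputable section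

namespace RankHC

/-! ### Concentration of permutation statistics via exchangeable pairs -/

section Perm

variable {ι : Type*} [Fintype ι] [DecidableEq ι]

/-- The permutation statistic `∑ᵢ a(i, σ i)`. -/
def permStat (a : ι → ι → ℝ) (σ : Equiv.Perm ι) : ℝ := ∑ i, a i (σ i)

/-- The mean of `permStat a` under the uniform distribution on permutations. -/
def permMean (a : ι → ι → ℝ) : ℝ := (∑ i, ∑ j, a i j) / Fintype.card ι

lemma permStat_sub_swap (a : ι → ι → ℝ) (σ : Equiv.Perm ι) (i j : ι) :
    permStat a σ - permStat a (σ * Equiv.swap i j)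
      = a i (σ i) + a j (σ j) - a i (σ j) - a j (σ i) := by
  rcases eq_or_ne i j with rfl | hij
  · rw [show Equiv.swap i i = 1 from Equiv.swap_self i, mul_one]
    ring
  unfold permStat
  rw [← Finset.sum_sub_distrib, ← Finset.sum_subset (Finset.subset_univ {i, j})]
  · rw [Finset.sum_pair hij]
    simp
    ring
  · intro k _ hk
    simp only [Finset.mem_insert, Finset.mem_singleton, not_or] at hk
    simp [Equiv.swap_apply_of_ne_of_ne hk.1 hk.2]

/-- The linear regression property of Stein's method: a random transposition pulls the statistic
towards its mean at a rate proportional to the deviation. -/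
lemma sum_permStat_sub_swap [Nonempty ι] (a : ι → ι → ℝ) (σ : Equiv.Perm ι) :
    ∑ i, ∑ j, (permStat a σ - permStat a (σ * Equiv.swap i j))
      = 2 * Fintype.card ι * (permStat a σ - permMean a) := by
  have hN : (Fintype.card ι : ℝ) ≠ 0 := by simp
  have h1 : ∑ i, ∑ j, a i (σ j) = ∑ i, ∑ j, a i j :=
    Finset.sum_congr rfl fun i _ => Equiv.sum_comp σ (a i)
  have h2 : ∑ i, ∑ j, a j (σ i) = ∑ i, ∑ j, a i j := by
    rw [Finset.sum_comm, h1]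
  simp only [permStat_sub_swap, Finset.sum_sub_distrib, Finset.sum_add_distrib, h1, h2]
  simp only [permMean, permStat, Finset.sum_const, Finset.card_univ, nsmul_eq_mul, ← Finset.mul_sum]
  field_simp
  ring

/-- For entries in `{0, 1}`, `(p + q - r - s)² ≤ 2 (p + q + r + s)`. The bound is proportional to `W
+ μ` rather than to the matrix size, which is what yields fluctuations of order `√μ`. -/
lemma sum_sq_permStat_sub_swap_le [Nonempty ι] {a : ι → ι → ℝ} (ha : ∀ i j, a i j = 0 ∨ a i j = 1)
    (σ : Equiv.Perm ι) :
    ∑ i, ∑ j, (permStat a σ - permStat a (σ * Equiv.swap i j)) ^ 2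
      ≤ 4 * Fintype.card ι * (permStat a σ + permMean a) := by
  have hN : (Fintype.card ι : ℝ) ≠ 0 := by simp
  have h1 : ∑ i, ∑ j, a i (σ j) = ∑ i, ∑ j, a i j :=
    Finset.sum_congr rfl fun i _ => Equiv.sum_comp σ (a i)
  have h2 : ∑ i, ∑ j, a j (σ i) = ∑ i, ∑ j, a i j := by
    rw [Finset.sum_comm, h1]
  calc _ ≤ ∑ i, ∑ j, 2 * (a i (σ i) + a j (σ j) + a i (σ j) + a j (σ i)) := by
        refine Finset.sum_le_sum fun i _ => Finset.sum_le_sum fun j _ => ?_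
        rw [permStat_sub_swap]
        rcases ha i (σ i) with h | h <;> rcases ha j (σ j) with h' | h' <;>
        rcases ha i (σ j) with h'' | h'' <;> rcases ha j (σ i) with h''' | h''' <;>
        rw [h, h', h'', h'''] <;> norm_num
    _ = _ := by
        simp only [← Finset.mul_sum, Finset.sum_add_distrib, h1, h2]
        simp only [permMean, permStat, Finset.sum_const, Finset.card_univ, nsmul_eq_mul,
          ← Finset.mul_sum]
        field_simp
        ring

lemma sum_perm_mul_swap (i j : ι) (h : Equiv.Perm ι → Equiv.Perm ι → ℝ) :
    ∑ σ, h (σ * Equiv.swap i j) σ = ∑ σ, h σ (σ * Equiv.swap i j) := by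
  rw [← Equiv.sum_comp (Equiv.mulRight (Equiv.swap i j))]
  simp [mul_assoc]

/-- The pair `(σ, σ * swap i j)` is exchangeable, so exchanging its members turns `(W - W') g(W')`
into `-(W - W') g(W)`; the right side is thus twice the sum of `(W - W') g(W)`, evaluated by the
regression property. -/
lemma sum_permStat_sub_mean_mul [Nonempty ι] (a : ι → ι → ℝ) (g : ℝ → ℝ) :
    4 * Fintype.card ι * ∑ σ, (permStat a σ - permMean a) * g (permStat a σ)
      = ∑ σ, ∑ i, ∑ j, (permStat a σ - permStat a (σ * Equiv.swap i j))
          * (g (permStat a σ) - g (permStat a (σ * Equiv.swap i j))) := by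
  have key : ∑ σ, ∑ i, ∑ j, (permStat a σ - permStat a (σ * Equiv.swap i j))
        * g (permStat a (σ * Equiv.swap i j))
      = - ∑ σ, ∑ i, ∑ j, (permStat a σ - permStat a (σ * Equiv.swap i j))
        * g (permStat a σ) := by
    have comm : ∀ F : Equiv.Perm ι → ι → ι → ℝ,
        ∑ σ, ∑ i, ∑ j, F σ i j = ∑ i, ∑ j, ∑ σ, F σ i j := by
      intro F
      rw [Finset.sum_comm]
      exact Finset.sum_congr rfl fun i _ => Finset.sum_comm
    rw [comm, comm, ← Finset.sum_neg_distrib]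
    refine Finset.sum_congr rfl fun i _ => ?_
    rw [← Finset.sum_neg_distrib]
    refine Finset.sum_congr rfl fun j _ => ?_
    rw [← Finset.sum_neg_distrib,
      ← sum_perm_mul_swap i j fun σ τ => (permStat a σ - permStat a τ) * g (permStat a τ)]
    exact Finset.sum_congr rfl fun σ _ => by ring
  simp only [mul_sub, Finset.sum_sub_distrib (f := fun _ => _ * g (permStat a _))]
  simp only [Finset.sum_sub_distrib]
  rw [key, sub_neg_eq_add, ← two_mul, Finset.mul_sum, Finset.mul_sum]
  refine Finset.sum_congr rfl fun σ _ => ?_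
  simp only [← Finset.sum_mul]
  rw [sum_permStat_sub_swap]
  ring

lemma sum_permStat [Nonempty ι] (a : ι → ι → ℝ) :
    ∑ σ, permStat a σ = Fintype.card (Equiv.Perm ι) * permMean a := by
  have h := sum_permStat_sub_mean_mul a fun _ => 1
  have hN : (Fintype.card ι : ℝ) ≠ 0 := by simp
  simp only [sub_self, mul_zero, Finset.sum_const_zero, mul_one, Finset.sum_sub_distrib,
    mul_eq_zero, hN, or_false, false_or, OfNat.ofNat_ne_zero, Finset.sum_const, Finset.card_univ,
    nsmul_eq_mul] at h
  linarith

/-- The variance of a permutation statistic with `0`-`1` entries is at most twice its mean. -/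
theorem sum_sq_permStat_sub_mean_le [Nonempty ι] {a : ι → ι → ℝ}
    (ha : ∀ i j, a i j = 0 ∨ a i j = 1) :
    ∑ σ, (permStat a σ - permMean a) ^ 2 ≤ Fintype.card (Equiv.Perm ι) * (2 * permMean a) := by
  have hN : (0 : ℝ) < 4 * Fintype.card ι := by positivity
  have h := sum_permStat_sub_mean_mul a fun x => x - permMean a
  simp only [sub_sub_sub_cancel_right, ← pow_two] at h
  have h2 := Finset.sum_le_sum fun σ (_ : σ ∈ Finset.univ) => sum_sq_permStat_sub_swap_le ha σ
  rw [← h, ← Finset.mul_sum] at h2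
  have h3 := le_of_mul_le_mul_left h2 hN
  rw [Finset.sum_add_distrib, sum_permStat] at h3
  simp only [Finset.sum_const, Finset.card_univ, nsmul_eq_mul] at h3
  linarith

/-- By convexity, the increment of `exp` is at most the length of the interval times the larger
endpoint value, which the sum of both values dominates. -/
lemma sub_mul_exp_sub_le {θ : ℝ} (hθ : 0 ≤ θ) (x y : ℝ) :
    (x - y) * (Real.exp (θ * x) - Real.exp (θ * y))
      ≤ θ * (x - y) ^ 2 * (Real.exp (θ * x) + Real.exp (θ * y)) := by
  have key : ∀ x y : ℝ, y ≤ x → (x - y) * (Real.exp (θ * x) - Real.exp (θ * y))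
      ≤ θ * (x - y) ^ 2 * (Real.exp (θ * x) + Real.exp (θ * y)) := by
    intro x y h
    have h1 : Real.exp (θ * x) - Real.exp (θ * y) ≤ θ * (x - y) * Real.exp (θ * x) := by
      have h2 := Real.add_one_le_exp (θ * y - θ * x)
      have h3 : Real.exp (θ * y) = Real.exp (θ * x) * Real.exp (θ * y - θ * x) := by
        rw [← Real.exp_add]; ring_nf
      have h4 := mul_le_mul_of_nonneg_left h2 (Real.exp_pos (θ * x)).le
      rw [← h3] at h4
      linarith
    have h5 := mul_le_mul_of_nonneg_left h1 (sub_nonneg.2 h)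
    have h6 : 0 ≤ θ * (x - y) ^ 2 * Real.exp (θ * y) := by positivity
    linarith
  rcases le_total y x with h | h
  · exact key x y h
  · have := key y x h
    linarith

lemma sum_permStat_sub_mean_mul_exp_le [Nonempty ι] {a : ι → ι → ℝ}
    (ha : ∀ i j, a i j = 0 ∨ a i j = 1) {θ : ℝ} (hθ : 0 ≤ θ) :
    ∑ σ, (permStat a σ - permMean a) * Real.exp (θ * permStat a σ)
      ≤ 2 * θ * ∑ σ, (permStat a σ + permMean a) * Real.exp (θ * permStat a σ) := by
  have hN : (0 : ℝ) < 4 * Fintype.card ι := by positivity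
  refine le_of_mul_le_mul_left ?_ hN
  rw [sum_permStat_sub_mean_mul a fun x => Real.exp (θ * x)]
  have comm : ∀ F : Equiv.Perm ι → ι → ι → ℝ,
      ∑ σ, ∑ i, ∑ j, F σ i j = ∑ i, ∑ j, ∑ σ, F σ i j := by
    intro F
    rw [Finset.sum_comm]
    exact Finset.sum_congr rfl fun i _ => Finset.sum_comm
  calc _ ≤ ∑ σ, ∑ i, ∑ j, (θ * ((permStat a σ - permStat a (σ * Equiv.swap i j)) ^ 2
          * Real.exp (θ * permStat a σ)) + θ * ((permStat a σ - permStat a (σ * Equiv.swap i j)) ^ 2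
          * Real.exp (θ * permStat a (σ * Equiv.swap i j)))) := by
        refine Finset.sum_le_sum fun σ _ => Finset.sum_le_sum fun i _ =>
          Finset.sum_le_sum fun j _ => ?_
        refine (sub_mul_exp_sub_le hθ _ _).trans_eq ?_
        ring
    _ = 2 * θ * ∑ σ, (∑ i, ∑ j, (permStat a σ - permStat a (σ * Equiv.swap i j)) ^ 2)
          * Real.exp (θ * permStat a σ) := by
        simp only [Finset.sum_add_distrib, ← Finset.mul_sum, Finset.sum_mul]
        have : ∑ σ, ∑ i, ∑ j, (permStat a σ - permStat a (σ * Equiv.swap i j)) ^ 2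
            * Real.exp (θ * permStat a (σ * Equiv.swap i j))
          = ∑ σ, ∑ i, ∑ j, (permStat a σ - permStat a (σ * Equiv.swap i j)) ^ 2
            * Real.exp (θ * permStat a σ) := by
          rw [comm, comm]
          refine Finset.sum_congr rfl fun i _ => Finset.sum_congr rfl fun j _ => ?_
          rw [← sum_perm_mul_swap i j fun σ τ =>
            (permStat a σ - permStat a τ) ^ 2 * Real.exp (θ * permStat a σ)]
          exact Finset.sum_congr rfl fun σ _ => by ring
        rw [this]
        ring
    _ ≤ 2 * θ * ∑ σ, (4 * Fintype.card ι * (permStat a σ + permMean a))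
          * Real.exp (θ * permStat a σ) := by
        refine mul_le_mul_of_nonneg_left (Finset.sum_le_sum fun σ _ => ?_) (by positivity)
        exact mul_le_mul_of_nonneg_right (sum_sq_permStat_sub_swap_le ha σ) (Real.exp_pos _).le
    _ = _ := by
        simp only [mul_assoc, ← Finset.mul_sum]
        ring

/-- A sub-Gaussian bound for the moment generating function of a permutation statistic with
`0`-`1` entries. -/
theorem sum_exp_permStat_sub_mean_le [Nonempty ι] {a : ι → ι → ℝ}
    (ha : ∀ i j, a i j = 0 ∨ a i j = 1) {θ : ℝ} (hθ : 0 ≤ θ) (hθ' : θ ≤ 1 / 4) :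
    ∑ σ, Real.exp (θ * (permStat a σ - permMean a))
      ≤ Fintype.card (Equiv.Perm ι) * Real.exp (4 * permMean a * θ ^ 2) := by
  set μ := permMean a with hμ
  have hμ0 : 0 ≤ μ := by
    refine div_nonneg (Finset.sum_nonneg fun i _ => Finset.sum_nonneg fun j _ => ?_) (by positivity)
    rcases ha i j with h | h <;> simp [h]
  -- The ratio of the moment generating function to the claimed bound (up to the factor `m 0`); it
  -- is shown to decrease on `[0, 1/4]`.
  let m : ℝ → ℝ := fun θ => (∑ σ, Real.exp (θ * permStat a σ)) * Real.exp (-(μ * θ + 4 * μ * θ ^ 2))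
  have hm : ∀ θ, HasDerivAt m ((∑ σ, permStat a σ * Real.exp (θ * permStat a σ))
      * Real.exp (-(μ * θ + 4 * μ * θ ^ 2)) + (∑ σ, Real.exp (θ * permStat a σ)) *
        (Real.exp (-(μ * θ + 4 * μ * θ ^ 2)) * (-(μ + 8 * μ * θ)))) θ := by
    intro θ
    refine HasDerivAt.mul ?_ ?_
    · refine HasDerivAt.fun_sum fun σ _ => ?_
      have := ((hasDerivAt_id θ).mul_const (permStat a σ)).exp
      simpa [mul_comm] using this
    · refine HasDerivAt.exp (HasDerivAt.neg ?_)
      have h1 := (hasDerivAt_id θ).const_mul μ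
      have h2 := ((hasDerivAt_id θ).pow 2).const_mul (4 * μ)
      convert! h1.add h2 using 1
      simp
      ring
  have hanti : AntitoneOn m (Set.Icc 0 (1 / 4)) := by
    refine antitoneOn_of_deriv_nonpos (convex_Icc _ _)
      (fun x _ => (hm x).continuousAt.continuousWithinAt)
      (fun x _ => (hm x).differentiableAt.differentiableWithinAt) fun x hx => ?_
    rw [interior_Icc] at hx
    rw [(hm x).deriv]
    have h1 := sum_permStat_sub_mean_mul_exp_le ha hx.1.le
    simp only [sub_mul, add_mul, Finset.sum_sub_distrib, Finset.sum_add_distrib,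
      ← Finset.mul_sum] at h1
    rw [← hμ] at h1
    set A := ∑ σ, permStat a σ * Real.exp (x * permStat a σ)
    set B := ∑ σ, Real.exp (x * permStat a σ)
    have hB : 0 ≤ B := Finset.sum_nonneg fun _ _ => (Real.exp_pos _).le
    have h2 : A ≤ (μ + 8 * μ * x) * B := by
      -- The exchangeable-pair bound reads `(1 - 2x) A ≤ (1 + 2x) μ B`, and `(1 - 2x)(1 + 8x) - (1 +
      -- 2x) = x (4 - 16x)` is nonnegative precisely up to `x = 1/4`.
      have h3 : (1 - 2 * x) * A ≤ (1 - 2 * x) * ((μ + 8 * μ * x) * B) := by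
        have h4 : 0 ≤ μ * B * x * (4 - 16 * x) := by
          have := hx.2
          have := hx.1
          exact mul_nonneg (by positivity) (by linarith)
        nlinarith
      exact le_of_mul_le_mul_left h3 (by linarith [hx.2])
    have h5 := (Real.exp_pos (-(μ * x + 4 * μ * x ^ 2)))
    nlinarith
  have h := hanti ⟨le_rfl, by norm_num⟩ ⟨hθ, hθ'⟩ hθ
  simp only [m, zero_mul, Real.exp_zero, Finset.sum_const, Finset.card_univ, nsmul_eq_mul, mul_one,
    mul_zero, ne_eq, OfNat.ofNat_ne_zero, not_false_eq_true, zero_pow, add_zero, neg_zero] at h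
  have e1 : ∑ σ, Real.exp (θ * (permStat a σ - μ))
      = (∑ σ, Real.exp (θ * permStat a σ)) * Real.exp (-(μ * θ + 4 * μ * θ ^ 2))
        * Real.exp (4 * μ * θ ^ 2) := by
    rw [mul_assoc, ← Real.exp_add, Finset.sum_mul]
    refine Finset.sum_congr rfl fun σ _ => ?_
    rw [← Real.exp_add]
    ring_nf
  rw [e1]
  exact mul_le_mul_of_nonneg_right h (Real.exp_pos _).le

/-- Chebyshev's inequality for the uniform distribution on permutations, lower tail. -/
theorem card_permStat_le_mean_sub [Nonempty ι] {a : ι → ι → ℝ}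
    (ha : ∀ i j, a i j = 0 ∨ a i j = 1) {x : ℝ} (hx : 0 < x) :
    ((Finset.univ.filter fun σ => permStat a σ ≤ permMean a - x).card : ℝ)
      ≤ Fintype.card (Equiv.Perm ι) * (2 * permMean a / x ^ 2) := by
  have h1 : ((Finset.univ.filter fun σ => permStat a σ ≤ permMean a - x).card : ℝ) * x ^ 2
      ≤ ∑ σ, (permStat a σ - permMean a) ^ 2 := by
    rw [← nsmul_eq_mul, ← Finset.sum_const]
    refine (Finset.sum_le_sum fun σ hσ => ?_).trans
      (Finset.sum_le_sum_of_subset_of_nonneg (Finset.filter_subset _ _) fun σ _ _ => sq_nonneg _)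
    have := (Finset.mem_filter.1 hσ).2
    nlinarith
  rw [← mul_div_assoc, le_div_iff₀ (by positivity)]
  exact h1.trans (sum_sq_permStat_sub_mean_le ha)

/-- An exponential tail bound for the uniform distribution on permutations, upper tail. -/
theorem card_mean_add_le_permStat [Nonempty ι] {a : ι → ι → ℝ}
    (ha : ∀ i j, a i j = 0 ∨ a i j = 1) (hμ : 1 ≤ permMean a) (x : ℝ) :
    ((Finset.univ.filter fun σ => permMean a + x ≤ permStat a σ).card : ℝ)
      ≤ Fintype.card (Equiv.Perm ι) * Real.exp (1 / 4 - x / (4 * √(permMean a))) := by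
  set μ := permMean a with hμd
  have hs : 1 ≤ √μ := Real.one_le_sqrt.2 hμ
  -- This makes `4 μ θ² = 1/4`, and `μ ≥ 1` keeps `θ` in the admissible range.
  set θ := 1 / (4 * √μ) with hθ
  have hθ0 : 0 ≤ θ := by positivity
  have hθ1 : θ ≤ 1 / 4 := by
    rw [hθ]
    exact one_div_le_one_div_of_le (by norm_num) (by linarith)
  have h1 : ((Finset.univ.filter fun σ => μ + x ≤ permStat a σ).card : ℝ) * Real.exp (θ * x)
      ≤ ∑ σ, Real.exp (θ * (permStat a σ - μ)) := by
    rw [← nsmul_eq_mul, ← Finset.sum_const]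
    refine (Finset.sum_le_sum fun σ hσ => ?_).trans (Finset.sum_le_sum_of_subset_of_nonneg
      (Finset.filter_subset _ _) fun σ _ _ => (Real.exp_pos _).le)
    have := (Finset.mem_filter.1 hσ).2
    gcongr
    linarith
  have h2 := h1.trans (sum_exp_permStat_sub_mean_le ha hθ0 hθ1)
  rw [Real.exp_sub, ← mul_div_assoc, le_div_iff₀ (Real.exp_pos _)]
  have e1 : x / (4 * √μ) = θ * x := by rw [hθ]; ring
  have e2 : 4 * μ * θ ^ 2 = 1 / 4 := by
    have h3 : √μ ^ 2 = μ := Real.sq_sqrt (by linarith)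
    rw [hθ, div_pow, mul_pow, h3]
    field_simp
  rw [e1, ← e2]
  exact h2

end Perm

/-! ### Ranks -/

lemma rank_comp_perm {n : ℕ} (x : Fin n → ℝ) (σ : Equiv.Perm (Fin n)) (i : Fin n) :
    rank (fun j => x (σ j)) i = rank x (σ i) := by
  unfold rank
  refine Finset.card_bij (fun j _ => σ j) (by simp) (by simp) fun j hj => ⟨σ.symm j, ?_, by simp⟩
  simpa using hj

lemma rank_congr {n : ℕ} {x y : Fin n → ℝ} (h : ∀ i j, x j ≤ x i ↔ y j ≤ y i) (i : Fin n) :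
    rank x i = rank y i := by
  simp [rank, h]

lemma rank_pos {n : ℕ} (x : Fin n → ℝ) (i : Fin n) : 1 ≤ rank x i :=
  Finset.card_pos.2 ⟨i, by simp⟩

lemma rank_le {n : ℕ} (x : Fin n → ℝ) (i : Fin n) : rank x i ≤ n :=
  (Finset.card_le_univ _).trans_eq (Fintype.card_fin n)

lemma rank_lt_rank {n : ℕ} {x : Fin n → ℝ} {i j : Fin n} (h : x i < x j) :
    rank x i < rank x j := by
  refine Finset.card_lt_card (Finset.ssubset_iff_of_subset ?_ |>.2 ⟨j, by simp, by simpa using h⟩)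
  exact fun k hk => by
    simp only [Finset.mem_filter, Finset.mem_univ, true_and] at hk ⊢
    exact hk.trans h.le

lemma rank_injective {n : ℕ} {x : Fin n → ℝ} (hx : Function.Injective x) :
    Function.Injective (rank x) := by
  intro i j hij
  by_contra hne
  rcases lt_or_gt_of_ne (hx.ne hne) with h | h
  · exact (rank_lt_rank h).ne hij
  · exact (rank_lt_rank h).ne hij.symm

/-- The ranks of distinct values are the numbers `1, …, n` in some order. -/
lemma sum_rank {n : ℕ} {x : Fin n → ℝ} (hx : Function.Injective x) (f : ℕ → ℝ) :
    ∑ i, f (rank x i) = ∑ r ∈ Finset.range n, f (r + 1) := by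
  have hinj : Function.Injective fun i => rank x i - 1 := by
    intro i j h
    have h1 := rank_pos x i
    have h2 := rank_pos x j
    exact rank_injective hx (by simp only at h; omega)
  have himg : Finset.univ.image (fun i => rank x i - 1) = Finset.range n := by
    refine Finset.eq_of_subset_of_card_le ?_ ?_
    · intro r hr
      obtain ⟨i, -, rfl⟩ := Finset.mem_image.1 hr
      have h1 := rank_pos x i
      have h2 := rank_le x i
      simp only [Finset.mem_range]
      omega
    · simp [Finset.card_image_of_injective _ hinj]
  rw [← himg, Finset.sum_image fun i _ j _ h => hinj h]
  exact Finset.sum_congr rfl fun i _ => by rw [Nat.sub_add_cancel (rank_pos x i)]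

/-- The indicator of `|r - s| ≤ t`. -/
def near (t r s : ℕ) : ℝ := if ((r : ℤ) - (s : ℤ)).natAbs ≤ t then 1 else 0

lemma near_eq_zero_or_one (t r s : ℕ) : near t r s = 0 ∨ near t r s = 1 := by
  unfold near
  split_ifs <;> simp

lemma near_nonneg (t r s : ℕ) : 0 ≤ near t r s := by
  rcases near_eq_zero_or_one t r s with h | h <;> simp [h]

lemma near_comm (t r s : ℕ) : near t r s = near t s r := by
  unfold near
  rw [← Int.natAbs_neg, neg_sub]

lemma near_succ (t r s : ℕ) : near t (r + 1) (s + 1) = near t r s := by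
  simp [near]

lemma sum_near_le (n t r : ℕ) : ∑ s ∈ Finset.range n, near t r s ≤ 2 * t + 1 := by
  simp only [near, Finset.sum_boole]
  have : ((Finset.range n).filter fun s : ℕ => ((r : ℤ) - (s : ℤ)).natAbs ≤ t).card
      ≤ (Finset.Icc (r - t) (r + t)).card := by
    refine Finset.card_le_card fun s hs => ?_
    simp only [Finset.mem_filter, Finset.mem_Icc] at hs ⊢
    omega
  rw [Nat.card_Icc] at this
  have h2 : ((Finset.range n).filter fun s : ℕ => ((r : ℤ) - (s : ℤ)).natAbs ≤ t).card
      ≤ 2 * t + 1 := by omega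
  exact_mod_cast h2

lemma sum_near_last {n t : ℕ} (h : t ≤ n) : ∑ s ∈ Finset.range n, near t n s = t := by
  simp only [near, Finset.sum_boole]
  have : ((Finset.range n).filter fun s : ℕ => ((n : ℤ) - (s : ℤ)).natAbs ≤ t)
      = Finset.Ico (n - t) n := by
    ext s
    simp only [Finset.mem_filter, Finset.mem_Ico, Finset.mem_range]
    omega
  rw [this, Nat.card_Ico, Nat.sub_sub_self h]

/-- Induction from `n = t`, where all `t²` entries are one. Each further row and column adds `t`
entries apiece and the diagonal one, hence `2t + 1`. -/
lemma sum_sum_near {n t : ℕ} (h : t ≤ n) :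
    ∑ r ∈ Finset.range n, ∑ s ∈ Finset.range n, near t r s
      = (n : ℝ) * (2 * t + 1) - (t : ℝ) * (t + 1) := by
  induction n, h using Nat.le_induction with
  | base =>
    have : ∀ r ∈ Finset.range t, ∑ s ∈ Finset.range t, near t r s = t := by
      intro r hr
      have h1 : ∀ s ∈ Finset.range t, near t r s = 1 := by
        intro s hs
        simp only [Finset.mem_range] at hr hs
        exact if_pos (by omega)
      rw [Finset.sum_congr rfl h1]
      simp
    rw [Finset.sum_congr rfl this]
    simp
    ring
  | succ n hn ih =>
    rw [Finset.sum_range_succ]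
    simp only [Finset.sum_range_succ _ n]
    rw [Finset.sum_add_distrib, ih, sum_near_last hn]
    simp only [near_comm t _ n]
    rw [sum_near_last hn]
    have : near t n n = 1 := if_pos (by simp)
    rw [this]
    push_cast
    ring

lemma sum_near_rank_le {n : ℕ} {x : Fin n → ℝ} (hx : Function.Injective x) (t r : ℕ)
    (hr : 1 ≤ r) : ∑ i, near t r (rank x i) ≤ 2 * t + 1 := by
  rw [sum_rank hx]
  obtain ⟨r, rfl⟩ := Nat.exists_eq_add_of_le' hr
  simp only [near_succ]
  exact sum_near_le n t r

lemma sum_sum_near_rank {n t : ℕ} (h : t ≤ n) {x y : Fin n → ℝ} (hx : Function.Injective x)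
    (hy : Function.Injective y) :
    ∑ i, ∑ j, near t (rank x i) (rank y j) = (n : ℝ) * (n * nullProb n t) := by
  simp only [sum_rank hy]
  rw [sum_rank hx fun r => ∑ s ∈ Finset.range n, near t r (s + 1)]
  simp only [near_succ]
  rw [sum_sum_near h, nullProb]
  rcases Nat.eq_zero_or_pos n with rfl | hn
  · obtain rfl : t = 0 := by omega
    simp
  · field_simp

lemma card_rankDiff_le {n : ℕ} (s : Fin n → ℝ × ℝ) (t : ℕ) :
    ((Finset.univ.filter fun i => rankDiff s i ≤ t).card : ℝ)
      = ∑ i, near t (rank (fun j => (s j).1) i) (rank (fun j => (s j).2) i) := by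
  simp only [near, Finset.sum_boole]
  rfl

/-- Uses `1 - u = (n - t)(n - t - 1) / n²`, which for `t ≤ n/2` and `n ≥ 4` is at least `1/4 -
1/(2n) ≥ 1/8`. The mean `n u` being at least one is what the exponential tail bound requires. -/
lemma nullProb_bounds {n t : ℕ} (hn : 4 ≤ n) (ht : t ≤ n / 2) :
    1 ≤ n * nullProb n t ∧ n * nullProb n t ≤ 2 * t + 1 ∧ 1 / 8 ≤ 1 - nullProb n t ∧
      1 - nullProb n t ≤ 1 := by
  have hn' : (4 : ℝ) ≤ n := by exact_mod_cast hn
  have ht' : 2 * (t : ℝ) ≤ n := by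
    have : 2 * t ≤ n := by omega
    exact_mod_cast this
  have h0 : (0 : ℝ) ≤ t := by positivity
  have hn0 : (0 : ℝ) < n := by linarith
  have e : n * nullProb n t = (2 * t + 1) - t * (t + 1) / n := by
    rw [nullProb]
    field_simp
  have e2 : 1 - nullProb n t = (n - t) * (n - t - 1) / n ^ 2 := by
    rw [nullProb]
    field_simp
    ring
  have h1 : (t : ℝ) * (t + 1) / n ≤ 2 * t := by
    rw [div_le_iff₀ hn0]
    nlinarith
  have h2 : 0 ≤ (t : ℝ) * (t + 1) / n := by positivity
  have h3 : 0 < n * nullProb n t := by rw [e]; linarith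
  have h4 : 0 < nullProb n t := by
    by_contra hneg
    nlinarith
  refine ⟨by rw [e]; linarith, by rw [e]; linarith, ?_, by linarith⟩
  rw [e2, le_div_iff₀ (by positivity)]
  nlinarith

lemma le_hcRank {n : ℕ} (s : Fin n → ℝ × ℝ) {t : ℕ} (ht : t ≤ n / 2) :
    standardizedCount s t ≤ hcRank s :=
  Finset.le_sup' (standardizedCount s) (by simpa using Nat.lt_succ_of_le ht)

lemma exists_le_standardizedCount {n : ℕ} {s : Fin n → ℝ × ℝ} {x : ℝ} (h : x ≤ hcRank s) :
    ∃ t ≤ n / 2, x ≤ standardizedCount s t := by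
  obtain ⟨t, ht, h'⟩ := (Finset.le_sup'_iff _).1 h
  exact ⟨t, Nat.lt_succ_iff.1 (by simpa using ht), h'⟩

lemma hcRank_congr {n : ℕ} {s s' : Fin n → ℝ × ℝ}
    (h₁ : ∀ i j, (s j).1 ≤ (s i).1 ↔ (s' j).1 ≤ (s' i).1)
    (h₂ : ∀ i j, (s j).2 ≤ (s i).2 ↔ (s' j).2 ≤ (s' i).2) : hcRank s = hcRank s' := by
  have : rankDiff s = rankDiff s' := by
    ext i
    simp only [rankDiff]
    rw [rank_congr (x := fun j => (s j).1) (y := fun j => (s' j).1) h₁,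
      rank_congr (x := fun j => (s j).2) (y := fun j => (s' j).2) h₂]
  unfold hcRank standardizedCount
  simp only [this]

/-! ### Measurability of ranks, counts and the statistic. -/

section Measurability

variable {Ω : Type*} [MeasurableSpace Ω]

lemma measurable_rank {n : ℕ} {x : Fin n → Ω → ℝ} (hx : ∀ i, Measurable (x i)) (i : Fin n) :
    Measurable fun ω => rank (fun j => x j ω) i := by
  simp only [rank, Finset.card_filter]
  refine Finset.measurable_sum _ fun j _ => ?_
  exact Measurable.ite (measurableSet_le (hx j) (hx i)) measurable_const measurable_const

lemma measurable_rankDiff {n : ℕ} (i : Fin n) :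
    Measurable fun s : Fin n → ℝ × ℝ => rankDiff s i := by
  have h1 : Measurable fun s : Fin n → ℝ × ℝ => rank (fun j => (s j).1) i :=
    measurable_rank (fun j => (measurable_pi_apply j).fst) i
  have h2 : Measurable fun s : Fin n → ℝ × ℝ => rank (fun j => (s j).2) i :=
    measurable_rank (fun j => (measurable_pi_apply j).snd) i
  exact (measurable_of_countable fun p : ℕ × ℕ => ((p.1 : ℤ) - (p.2 : ℤ)).natAbs).comp
    (h1.prodMk h2)

lemma measurable_card_rankDiff_le {n : ℕ} (t : ℕ) : Measurable fun s : Fin n → ℝ × ℝ =>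
    ((Finset.univ.filter fun i => rankDiff s i ≤ t).card : ℝ) := by
  simp only [Finset.card_filter, Nat.cast_sum]
  refine Finset.measurable_sum _ fun i _ => ?_
  exact (measurable_of_countable fun m : ℕ => ((if m ≤ t then 1 else 0 : ℕ) : ℝ)).comp
    (measurable_rankDiff i)

lemma measurable_standardizedCount {n : ℕ} (t : ℕ) :
    Measurable fun s : Fin n → ℝ × ℝ => standardizedCount s t :=
  ((measurable_card_rankDiff_le t).sub_const _).div_const _

lemma measurable_hcRank {n : ℕ} : Measurable (hcRank (n := n)) := by
  have : hcRank (n := n) = (Finset.range (n / 2 + 1)).sup' Finset.nonempty_range_add_one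
      fun t s => standardizedCount s t := by
    ext s
    simp [hcRank, Finset.sup'_apply]
  rw [this]
  exact Finset.measurable_sup' _ fun t _ => measurable_standardizedCount t

end Measurability

/-! ### The latent Gaussian pairs -/

instance : NullSingletonClass (gaussianReal 0 1) := nullSingletonClass_gaussianReal one_ne_zero

lemma measurable_stdNormalCDF : Measurable stdNormalCDF := (monotone_cdf _).measurable

/-- Lebesgue measure is absolutely continuous with respect to the Gaussian law, so nonempty
intervals `Ioc x y` have positive mass. -/
lemma strictMono_stdNormalCDF : StrictMono stdNormalCDF := by
  intro x y hxy
  have h1 : gaussianReal 0 1 (Set.Ioc x y) ≠ 0 := by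
    intro h
    have := gaussianReal_absolutelyContinuous' 0 one_ne_zero h
    rw [Real.volume_Ioc, ENNReal.ofReal_eq_zero] at this
    linarith
  have h2 : gaussianReal 0 1 (Set.Ioc x y) = ENNReal.ofReal (stdNormalCDF y - stdNormalCDF x) := by
    have := (cdf (gaussianReal 0 1)).measure_Ioc x y
    rwa [measure_cdf] at this
  rw [h2, ne_eq, ENNReal.ofReal_eq_zero] at h1
  linarith

lemma gaussianPDFReal_le_one (x : ℝ) : gaussianPDFReal 0 1 x ≤ 1 := by
  rw [gaussianPDFReal]
  have h1 : (√(2 * Real.pi * ((1 : NNReal) : ℝ)))⁻¹ ≤ 1 := by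
    refine inv_le_one_of_one_le₀ (Real.one_le_sqrt.2 ?_)
    have := Real.pi_gt_three
    simp
    linarith
  have h2 : Real.exp (-(x - 0) ^ 2 / (2 * ((1 : NNReal) : ℝ))) ≤ 1 := by
    refine Real.exp_le_one_iff.2 ?_
    have := sq_nonneg (x - 0)
    simp only [NNReal.coe_one]
    linarith
  exact mul_le_one₀ h1 (Real.exp_pos _).le h2

/-- The density is at most one. This converts closeness of the latent coordinates into closeness of
their normalized ranks. -/
lemma abs_stdNormalCDF_sub_le (x y : ℝ) : |stdNormalCDF x - stdNormalCDF y| ≤ |x - y| := by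
  have key : ∀ x y : ℝ, x ≤ y → stdNormalCDF y - stdNormalCDF x ≤ y - x := by
    intro x y hxy
    have h2 : gaussianReal 0 1 (Set.Ioc x y)
        = ENNReal.ofReal (stdNormalCDF y - stdNormalCDF x) := by
      have := (cdf (gaussianReal 0 1)).measure_Ioc x y
      rwa [measure_cdf] at this
    have h3 : gaussianReal 0 1 (Set.Ioc x y) ≤ ENNReal.ofReal (y - x) := by
      rw [gaussianReal_apply 0 one_ne_zero, ← Real.volume_Ioc]
      calc _ ≤ ∫⁻ _ in Set.Ioc x y, 1 := by
            refine lintegral_mono fun z => ?_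
            rw [gaussianPDF]
            exact ENNReal.ofReal_le_one.2 (gaussianPDFReal_le_one z)
        _ = _ := by simp
    rw [h2, ENNReal.ofReal_le_ofReal_iff (by linarith)] at h3
    exact h3
  rcases le_total x y with h | h
  · rw [abs_sub_comm, abs_sub_comm x y, abs_of_nonneg (sub_nonneg.2 h),
      abs_of_nonneg (sub_nonneg.2 (strictMono_stdNormalCDF.monotone h))]
    exact key x y h
  · rw [abs_of_nonneg (sub_nonneg.2 h),
      abs_of_nonneg (sub_nonneg.2 (strictMono_stdNormalCDF.monotone h))]
    exact key y x h

/-- The coordinates of a vector in the plane, as a pair. -/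
def toPair (z : EuclideanSpace ℝ (Fin 2)) : ℝ × ℝ := (z 0, z 1)

lemma measurable_toPair : Measurable toPair := by
  unfold toPair
  fun_prop

/-- The law of a pair of standard normal variables with correlation `ρ`. -/
def gaussianPair (ρ : ℝ) : Measure (ℝ × ℝ) :=
  (multivariateGaussian 0 (corrMatrix ρ)).map toPair

instance (ρ : ℝ) : IsProbabilityMeasure (gaussianPair ρ) :=
  Measure.isProbabilityMeasure_map measurable_toPair.aemeasurable

/-- The quadratic form is `ρ (x₀ + x₁)² + (1 - ρ)(x₀² + x₁²)`; the degenerate case `ρ = 1` is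
included. -/
lemma posSemidef_corrMatrix {ρ : ℝ} (h0 : 0 ≤ ρ) (h1 : ρ ≤ 1) : (corrMatrix ρ).PosSemidef := by
  refine Matrix.PosSemidef.of_dotProduct_mulVec_nonneg ?_ fun x => ?_
  · ext i j
    fin_cases i <;> fin_cases j <;> simp [corrMatrix]
  · simp [corrMatrix, Matrix.mulVec, dotProduct, Fin.sum_univ_two]
    nlinarith [mul_nonneg h0 (sq_nonneg (x 0 + x 1)),
      mul_nonneg (sub_nonneg.2 h1) (sq_nonneg (x 0)), mul_nonneg (sub_nonneg.2 h1) (sq_nonneg (x 1))]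

lemma map_toPair_stdGaussian : (multivariateGaussian 0 (1 : Matrix (Fin 2) (Fin 2) ℝ)).map toPair
    = (gaussianReal 0 1).prod (gaussianReal 0 1) := by
  rw [multivariateGaussian_zero_one, ← map_pi_eq_stdGaussian,
    Measure.map_map measurable_toPair (by fun_prop)]
  exact (measurePreserving_finTwoArrow (gaussianReal 0 1)).map_eq

lemma measurePreserving_fst_gaussianPair {ρ : ℝ} (h0 : 0 ≤ ρ) (h1 : ρ ≤ 1) :
    MeasurePreserving Prod.fst (gaussianPair ρ) (gaussianReal 0 1) := by
  refine ⟨measurable_fst, ?_⟩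
  rw [gaussianPair, Measure.map_map measurable_fst measurable_toPair]
  have := (measurePreserving_eval_multivariateGaussian (μ := 0) (posSemidef_corrMatrix h0 h1)
    (i := 0)).map_eq
  simp only [corrMatrix, PiLp.zero_apply, Matrix.of_apply, Matrix.cons_val', Matrix.cons_val_zero,
    Matrix.cons_val_fin_one, Real.toNNReal_one] at this
  exact this

lemma measurePreserving_snd_gaussianPair {ρ : ℝ} (h0 : 0 ≤ ρ) (h1 : ρ ≤ 1) :
    MeasurePreserving Prod.snd (gaussianPair ρ) (gaussianReal 0 1) := by
  refine ⟨measurable_snd, ?_⟩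
  rw [gaussianPair, Measure.map_map measurable_snd measurable_toPair]
  have := (measurePreserving_eval_multivariateGaussian (μ := 0) (posSemidef_corrMatrix h0 h1)
    (i := 1)).map_eq
  simp only [corrMatrix, PiLp.zero_apply, Matrix.of_apply, Matrix.cons_val',
    Matrix.cons_val_one, Matrix.cons_val_fin_one, Real.toNNReal_one] at this
  exact this

lemma memLp_eval_multivariateGaussian (S : Matrix (Fin 2) (Fin 2) ℝ) (i : Fin 2) :
    MemLp (fun z : EuclideanSpace ℝ (Fin 2) => z i) 2 (multivariateGaussian 0 S) :=
  (IsGaussian.memLp_two_id (μ := multivariateGaussian 0 S)).continuousLinearMap_comp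
    (EuclideanSpace.proj i : EuclideanSpace ℝ (Fin 2) →L[ℝ] ℝ)

lemma integrable_sq_sub_gaussianPair (ρ : ℝ) :
    Integrable (fun z : ℝ × ℝ => (z.1 - z.2) ^ 2) (gaussianPair ρ) := by
  rw [gaussianPair, integrable_map_measure (by fun_prop) measurable_toPair.aemeasurable]
  exact ((memLp_eval_multivariateGaussian _ 0).sub
    (memLp_eval_multivariateGaussian _ 1)).integrable_sq

lemma integral_sq_sub_gaussianPair {ρ : ℝ} (h0 : 0 ≤ ρ) (h1 : ρ ≤ 1) :
    ∫ z, (z.1 - z.2) ^ 2 ∂gaussianPair ρ = 2 * (1 - ρ) := by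
  rw [gaussianPair, integral_map measurable_toPair.aemeasurable (by fun_prop)]
  have hS := posSemidef_corrMatrix h0 h1
  have m0 := memLp_eval_multivariateGaussian (corrMatrix ρ) 0
  have m1 := memLp_eval_multivariateGaussian (corrMatrix ρ) 1
  have mean : ∀ i : Fin 2, ∫ z, z i ∂multivariateGaussian 0 (corrMatrix ρ) = 0 := by
    intro i
    have := (EuclideanSpace.proj i : EuclideanSpace ℝ (Fin 2) →L[ℝ] ℝ).integral_comp_id_comm
      (IsGaussian.integrable_id (μ := multivariateGaussian 0 (corrMatrix ρ)))
    simpa using this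
  have hv := variance_fun_sub m0 m1
  rw [variance_eval_multivariateGaussian hS, variance_eval_multivariateGaussian hS,
    covariance_eval_multivariateGaussian hS, variance_eq_integral (by fun_prop),
    integral_sub (m0.integrable (by norm_num)) (m1.integrable (by norm_num)), mean, mean] at hv
  simp only [sub_zero] at hv
  simp only [toPair]
  rw [hv]
  simp [corrMatrix]
  ring

/-- The law of a latent pair: a mixture of the standard Gaussian law on the plane and of `κ`. -/
def pairMixture (ε : ℝ) (κ : Measure (ℝ × ℝ)) : Measure (ℝ × ℝ) :=
  ENNReal.ofReal (1 - ε) • (gaussianReal 0 1).prod (gaussianReal 0 1) + ENNReal.ofReal ε • κ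

lemma map_toPair_gaussianMixture (ε ρ : ℝ) :
    (gaussianMixture ε ρ).map toPair = pairMixture ε (gaussianPair ρ) := by
  rw [gaussianMixture, Measure.map_add _ _ measurable_toPair, Measure.map_smul, Measure.map_smul,
    map_toPair_stdGaussian]
  rfl

lemma isProbabilityMeasure_smul_add_smul {α : Type*} [MeasurableSpace α] {μ ν : Measure α}
    [IsProbabilityMeasure μ] [IsProbabilityMeasure ν] {ε : ℝ} (h0 : 0 ≤ ε) (h1 : ε ≤ 1) :
    IsProbabilityMeasure (ENNReal.ofReal (1 - ε) • μ + ENNReal.ofReal ε • ν) := by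
  constructor
  simp only [Measure.coe_add, Measure.coe_smul, Pi.add_apply, Pi.smul_apply, measure_univ,
    smul_eq_mul, mul_one]
  rw [← ENNReal.ofReal_add (by linarith) h0]
  simp

lemma isProbabilityMeasure_pairMixture {ε : ℝ} (h0 : 0 ≤ ε) (h1 : ε ≤ 1) (κ : Measure (ℝ × ℝ))
    [IsProbabilityMeasure κ] : IsProbabilityMeasure (pairMixture ε κ) :=
  isProbabilityMeasure_smul_add_smul h0 h1

lemma measurePreserving_pairMixture {ε : ℝ} (h0 : 0 ≤ ε) (h1 : ε ≤ 1) {κ : Measure (ℝ × ℝ)}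
    {f : ℝ × ℝ → ℝ}
    (hf : MeasurePreserving f ((gaussianReal 0 1).prod (gaussianReal 0 1)) (gaussianReal 0 1))
    (hf' : MeasurePreserving f κ (gaussianReal 0 1)) :
    MeasurePreserving f (pairMixture ε κ) (gaussianReal 0 1) := by
  refine ⟨hf.measurable, ?_⟩
  rw [pairMixture, Measure.map_add _ _ hf.measurable, Measure.map_smul, Measure.map_smul,
    hf.map_eq, hf'.map_eq, ← add_smul, ← ENNReal.ofReal_add (by linarith) h0]
  simp

lemma measurePreserving_fst_pairMixture {ε : ℝ} (h0 : 0 ≤ ε) (h1 : ε ≤ 1) {κ : Measure (ℝ × ℝ)}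
    (hκ : MeasurePreserving Prod.fst κ (gaussianReal 0 1)) :
    MeasurePreserving Prod.fst (pairMixture ε κ) (gaussianReal 0 1) :=
  measurePreserving_pairMixture h0 h1 measurePreserving_fst hκ

lemma measurePreserving_snd_pairMixture {ε : ℝ} (h0 : 0 ≤ ε) (h1 : ε ≤ 1) {κ : Measure (ℝ × ℝ)}
    (hκ : MeasurePreserving Prod.snd κ (gaussianReal 0 1)) :
    MeasurePreserving Prod.snd (pairMixture ε κ) (gaussianReal 0 1) :=
  measurePreserving_pairMixture h0 h1 measurePreserving_snd hκ

/-- Independent draws from a law without atoms are almost surely distinct. -/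
lemma ae_injective_pi {n : ℕ} (μ : Measure ℝ) [IsProbabilityMeasure μ] [NullSingletonClass μ] :
    ∀ᵐ x ∂Measure.pi fun _ : Fin n => μ, Function.Injective x := by
  have key : ∀ i j : Fin n, i ≠ j → ∀ᵐ x ∂Measure.pi fun _ : Fin n => μ, x i ≠ x j := by
    intro i j hij
    have hind : IndepFun (fun x : Fin n → ℝ => x i) (fun x => x j)
        (Measure.pi fun _ : Fin n => μ) :=
      (iIndepFun_pi (μ := fun _ : Fin n => μ) (X := fun _ x => x)
        fun _ => aemeasurable_id').indepFun hij
    have hmap := (indepFun_iff_map_prod_eq_prod_map_map (measurable_pi_apply i).aemeasurable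
      (measurable_pi_apply j).aemeasurable).1 hind
    have hi := (measurePreserving_eval (fun _ : Fin n => μ) i).map_eq
    have hj := (measurePreserving_eval (fun _ : Fin n => μ) j).map_eq
    have hd : ∀ᵐ p ∂μ.prod μ, p.1 ≠ p.2 := by
      refine (Measure.ae_prod_iff_ae_ae (p := fun p : ℝ × ℝ => p.1 ≠ p.2)
        (measurableSet_eq_fun measurable_fst measurable_snd).compl).2 (ae_of_all _ fun x => ?_)
      filter_upwards [compl_mem_ae_iff.2 (measure_singleton (μ := μ) x)] with y hy h
      exact hy h.symm
    have e : (Measure.pi fun _ : Fin n => μ).map (fun x => (x i, x j)) = μ.prod μ := by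
      rw [hmap]
      exact congrArg₂ _ hi hj
    rw [← e] at hd
    exact ae_of_ae_map (f := fun x : Fin n → ℝ => (x i, x j))
      ((measurable_pi_apply i).prodMk (measurable_pi_apply j)).aemeasurable hd
  have := ae_all_iff.2 fun i => ae_all_iff.2 fun j => ae_all_iff.2 (key i j)
  filter_upwards [this] with x hx i j h
  by_contra hne
  exact hx i j hne h

lemma ae_injective_comp_pi {n : ℕ} {α : Type*} [MeasurableSpace α] {μ : Measure α} {f : α → ℝ}
    (hf : MeasurePreserving f μ (gaussianReal 0 1)) [IsProbabilityMeasure μ] :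
    ∀ᵐ x ∂Measure.pi fun _ : Fin n => μ, Function.Injective fun i => f (x i) :=
  (measurePreserving_pi (fun _ : Fin n => μ) (fun _ => gaussianReal 0 1)
    fun _ => hf).quasiMeasurePreserving.ae (ae_injective_pi (gaussianReal 0 1))

lemma IsGaussianMixtureCopula.isProbabilityMeasure_sampleLaw {F G : ℝ → ℝ} {ε ρ : ℝ}
    {Q : Measure (ℝ × ℝ)} (h : IsGaussianMixtureCopula F G ε ρ Q) (n : ℕ) :
    IsProbabilityMeasure (sampleLaw n Q) := by
  obtain ⟨π, hQ, hZ, -⟩ := h.exists_latent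
  have : IsProbabilityMeasure (gaussianMixture ε ρ) :=
    isProbabilityMeasure_smul_add_smul h.weight_nonneg (by linarith [h.weight_lt])
  have hπ : IsProbabilityMeasure π := by
    rw [← hZ] at this
    exact Measure.isProbabilityMeasure_of_map Prod.snd
  have : IsProbabilityMeasure Q := hQ ▸ Measure.isProbabilityMeasure_map measurable_fst.aemeasurable
  unfold sampleLaw
  infer_instance

/-- The higher criticism rank statistic has the same law as if the latent pairs were observed. -/
theorem map_hcRank_sampleLaw {F G : ℝ → ℝ} {ε ρ : ℝ} {Q : Measure (ℝ × ℝ)}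
    (h : IsGaussianMixtureCopula F G ε ρ Q) (n : ℕ) :
    (sampleLaw n Q).map hcRank
      = (Measure.pi fun _ : Fin n => pairMixture ε (gaussianPair ρ)).map hcRank := by
  obtain ⟨π, hQ, hZ, hae⟩ := h.exists_latent
  have hε1 : ε ≤ 1 := by linarith [h.weight_lt]
  have := isProbabilityMeasure_pairMixture h.weight_nonneg hε1 (gaussianPair ρ)
  have hP : MeasurePreserving (fun p : (ℝ × ℝ) × EuclideanSpace ℝ (Fin 2) => toPair p.2) π
      (pairMixture ε (gaussianPair ρ)) := by
    refine ⟨measurable_toPair.comp measurable_snd, ?_⟩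
    rw [← map_toPair_gaussianMixture, ← hZ, Measure.map_map measurable_toPair measurable_snd]
    rfl
  have : IsProbabilityMeasure π := by
    refine ⟨?_⟩
    rw [← Set.preimage_univ (f := fun p : (ℝ × ℝ) × EuclideanSpace ℝ (Fin 2) => toPair p.2),
      hP.measure_preimage nullMeasurableSet_univ, measure_univ]
  have hX : MeasurePreserving Prod.fst π Q := ⟨measurable_fst, hQ⟩
  have : IsProbabilityMeasure Q := hQ ▸ Measure.isProbabilityMeasure_map measurable_fst.aemeasurable
  have hQn := measurePreserving_pi (fun _ : Fin n => π) (fun _ => Q) fun _ => hX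
  have hPn := measurePreserving_pi (fun _ : Fin n => π)
    (fun _ => pairMixture ε (gaussianPair ρ)) fun _ => hP
  rw [sampleLaw, ← hQn.map_eq, ← hPn.map_eq, Measure.map_map measurable_hcRank hQn.measurable,
    Measure.map_map measurable_hcRank hPn.measurable]
  refine Measure.map_congr ?_
  have h1 := hPn.quasiMeasurePreserving.ae (ae_injective_comp_pi
    (measurePreserving_fst_pairMixture h.weight_nonneg hε1
      (measurePreserving_fst_gaussianPair h.corr_nonneg h.corr_le)))
  have h2 := hPn.quasiMeasurePreserving.ae (ae_injective_comp_pi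
    (measurePreserving_snd_pairMixture h.weight_nonneg hε1
      (measurePreserving_snd_gaussianPair h.corr_nonneg h.corr_le)))
  have h3 : ∀ᵐ p ∂Measure.pi fun _ : Fin n => π, ∀ i, F (p i).1.1 = stdNormalCDF ((p i).2 0) ∧
      G (p i).1.2 = stdNormalCDF ((p i).2 1) :=
    ae_all_iff.2 fun i =>
      (measurePreserving_eval (fun _ : Fin n => π) i).quasiMeasurePreserving.ae hae
  -- `H` may have flat pieces, but distinct `z i` give distinct values `H (x i)`, so no two
  -- observations share a flat piece and the order of the `x i` is that of the `z i`.
  have key : ∀ {H : ℝ → ℝ} (_ : Monotone H) {x z : Fin n → ℝ} (_ : Function.Injective z)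
      (_ : ∀ i, H (x i) = stdNormalCDF (z i)) (i j : Fin n), x j ≤ x i ↔ z j ≤ z i := by
    intro H hH x z hz hxz i j
    constructor
    · intro hij
      have := hH hij
      rw [hxz, hxz] at this
      exact strictMono_stdNormalCDF.le_iff_le.1 this
    · intro hij
      by_contra hcon
      have := hH (not_le.1 hcon).le
      rw [hxz, hxz] at this
      have h4 := strictMono_stdNormalCDF.le_iff_le.1 this
      have h5 := hz (le_antisymm hij h4)
      rw [h5] at hcon
      exact hcon le_rfl
  filter_upwards [h1, h2, h3] with p hp1 hp2 hp3
  exact hcRank_congr (key h.distr_F.monotone hp1 fun i => (hp3 i).1)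
    (key h.distr_G.monotone hp2 fun i => (hp3 i).2)

/-! ### Averaging over permutations -/

lemma measurePreserving_comp_perm {n : ℕ} (μ : Measure ℝ) [IsProbabilityMeasure μ]
    (σ : Equiv.Perm (Fin n)) : MeasurePreserving (fun y : Fin n → ℝ => fun i => y (σ i))
      (Measure.pi fun _ => μ) (Measure.pi fun _ => μ) := by
  have h := measurePreserving_piCongrLeft (fun _ : Fin n => μ) σ.symm
  have e : (fun y : Fin n → ℝ => fun i => y (σ i))
      = MeasurableEquiv.piCongrLeft (fun _ : Fin n => ℝ) σ.symm := by
    ext y i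
    simp [MeasurableEquiv.piCongrLeft, Equiv.piCongrLeft, Equiv.piCongrLeft']
  rw [e]
  exact h

/-- If a family of permutations sends almost every sample into `A` for at most a proportion `δ` of
its members, then `A` has probability at most `δ` under an exchangeable product law. -/
lemma real_le_of_card_perm_le {n : ℕ} (μ : Measure ℝ) [IsProbabilityMeasure μ] {τ : Type*}
    [Fintype τ] [Nonempty τ] (g : τ → Equiv.Perm (Fin n)) {A : Set (Fin n → ℝ)}
    (hA : MeasurableSet A) [DecidablePred (· ∈ A)] {δ : ℝ}
    (h : ∀ᵐ y ∂Measure.pi fun _ : Fin n => μ,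
      ((Finset.univ.filter fun k => (fun i => y (g k i)) ∈ A).card : ℝ) ≤ Fintype.card τ * δ) :
    (Measure.pi fun _ : Fin n => μ).real A ≤ δ := by
  set P := Measure.pi fun _ : Fin n => μ
  have hτ : (0 : ℝ) < Fintype.card τ := by positivity
  refine le_of_mul_le_mul_left ?_ hτ
  have hpre : ∀ k, MeasurableSet ((fun y : Fin n → ℝ => fun i => y (g k i)) ⁻¹' A) := fun k =>
    (measurePreserving_comp_perm μ (g k)).measurable hA
  have hint : ∀ k, Integrable (((fun y : Fin n → ℝ => fun i => y (g k i)) ⁻¹' A).indicator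
      fun _ => (1 : ℝ)) P := fun k => (integrable_const 1).indicator (hpre k)
  have e1 : ∀ k, ∫ y, (((fun y : Fin n → ℝ => fun i => y (g k i)) ⁻¹' A).indicator
      fun _ => (1 : ℝ)) y ∂P = P.real A := by
    intro k
    rw [integral_indicator_const _ (hpre k), smul_eq_mul, mul_one]
    exact (measurePreserving_comp_perm μ (g k)).measureReal_preimage hA.nullMeasurableSet
  calc (Fintype.card τ : ℝ) * P.real A
      = ∫ y, ∑ k, (((fun y : Fin n → ℝ => fun i => y (g k i)) ⁻¹' A).indicator
          fun _ => (1 : ℝ)) y ∂P := by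
        rw [integral_finsetSum _ fun k _ => hint k, Finset.sum_congr rfl fun k _ => e1 k]
        simp
    _ ≤ ∫ _, Fintype.card τ * δ ∂P := by
        refine integral_mono_ae (integrable_finsetSum _ fun k _ => hint k) (integrable_const _) ?_
        filter_upwards [h] with y hy
        refine le_trans (le_of_eq ?_) hy
        rw [← Finset.sum_boole]
        refine Finset.sum_congr rfl fun k _ => ?_
        by_cases hk : (fun i => y (g k i)) ∈ A
        · rw [if_pos hk]
          exact Set.indicator_of_mem
            (show y ∈ (fun y : Fin n → ℝ => fun i => y (g k i)) ⁻¹' A from hk) _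
        · rw [if_neg hk]
          exact Set.indicator_of_notMem
            (show y ∉ (fun y : Fin n → ℝ => fun i => y (g k i)) ⁻¹' A from hk) _
    _ = Fintype.card τ * δ := by simp

lemma real_prod_le {α β : Type*} [MeasurableSpace α] [MeasurableSpace β] {μ : Measure α}
    {ν : Measure β} [IsProbabilityMeasure μ] [IsProbabilityMeasure ν] {A : Set (α × β)}
    (hA : MeasurableSet A) {δ : ℝ} (hδ : 0 ≤ δ)
    (h : ∀ᵐ x ∂μ, ν.real (Prod.mk x ⁻¹' A) ≤ δ) : (μ.prod ν).real A ≤ δ := by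
  refine ENNReal.toReal_le_of_le_ofReal hδ ?_
  rw [Measure.prod_apply hA]
  calc _ ≤ ∫⁻ _, ENNReal.ofReal δ ∂μ := by
        refine lintegral_mono_ae ?_
        filter_upwards [h] with x hx
        rw [← ENNReal.ofReal_toReal (measure_ne_top ν (Prod.mk x ⁻¹' A))]
        exact ENNReal.ofReal_le_ofReal hx
    _ = _ := by simp

/-! ### The null hypothesis -/

lemma permMean_near_rank {n t : ℕ} (hn : 0 < n) (ht : t ≤ n) {x y : Fin n → ℝ}
    (hx : Function.Injective x) (hy : Function.Injective y) :
    permMean (fun i j => near t (rank x i) (rank y j)) = n * nullProb n t := by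
  rw [permMean, sum_sum_near_rank ht hx hy, Fintype.card_fin]
  field_simp

/-- An exponential tail bound for the standardized counts under the null. -/
lemma real_le_standardizedCount {n t : ℕ} (hn : 4 ≤ n) (ht : t ≤ n / 2) {L : ℝ} (hL : 0 ≤ L) :
    (Measure.pi fun _ : Fin n => (gaussianReal 0 1).prod (gaussianReal 0 1)).real
      {s | L ≤ standardizedCount s t} ≤ Real.exp (1 / 4 - L / 12) := by
  classical
  have hMP := measurePreserving_arrowProdEquivProdArrow ℝ ℝ (Fin n)
    (fun _ => gaussianReal 0 1) (fun _ => gaussianReal 0 1)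
  set A : Set ((Fin n → ℝ) × (Fin n → ℝ)) :=
    {p | L ≤ standardizedCount (fun i => (p.1 i, p.2 i)) t} with hAdef
  have hA : MeasurableSet A := by
    refine measurableSet_le measurable_const ((measurable_standardizedCount t).comp ?_)
    fun_prop
  rw [show {s : Fin n → ℝ × ℝ | L ≤ standardizedCount s t}
    = MeasurableEquiv.arrowProdEquivProdArrow ℝ ℝ (Fin n) ⁻¹' A from rfl,
    hMP.measureReal_preimage hA.nullMeasurableSet]
  refine real_prod_le hA (Real.exp_pos _).le ?_
  filter_upwards [ae_injective_pi (n := n) (gaussianReal 0 1)] with x hx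
  have hAx : MeasurableSet (Prod.mk x ⁻¹' A) := measurable_prodMk_left hA
  -- With `x` fixed, the event is averaged over all rearrangements of `y`, reducing it to a count of
  -- permutations.
  refine real_le_of_card_perm_le (gaussianReal 0 1) (fun σ : Equiv.Perm (Fin n) => σ) hAx ?_
  filter_upwards [ae_injective_pi (n := n) (gaussianReal 0 1)] with y hy
  obtain ⟨hu1, -, hu2, -⟩ := nullProb_bounds hn ht
  set a : Fin n → Fin n → ℝ := fun i j => near t (rank x i) (rank y j) with ha
  have : Nonempty (Fin n) := ⟨⟨0, by omega⟩⟩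
  have hmean : permMean a = n * nullProb n t :=
    permMean_near_rank (by omega) (by omega) hx hy
  set u := nullProb n t
  have hpos : 0 < n * u * (1 - u) := mul_pos (by linarith) (by linarith)
  have hsq : 0 < √(n * u * (1 - u)) := Real.sqrt_pos.2 hpos
  have hcard := card_mean_add_le_permStat (a := a) (fun i j => near_eq_zero_or_one _ _ _)
    (by rw [hmean]; exact hu1) (L * √(n * u * (1 - u)))
  refine le_trans ?_ (hcard.trans ?_)
  · refine Nat.cast_le.2 (Finset.card_le_card fun σ hσ => ?_)
    simp only [Finset.mem_filter, Finset.mem_univ, true_and, Set.mem_preimage, hAdef,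
      Set.mem_ofPred_eq] at hσ ⊢
    rw [standardizedCount, le_div_iff₀ hsq, card_rankDiff_le] at hσ
    simp only [rank_comp_perm] at hσ
    rw [hmean, permStat]
    linarith
  · refine mul_le_mul_of_nonneg_left (Real.exp_le_exp.2 ?_) (by positivity)
    rw [hmean, Real.sqrt_mul (by linarith)]
    have h1 : 0 < √(n * u) := Real.sqrt_pos.2 (by linarith)
    -- From `1 - u ≥ 1/8 ≥ 1/9`; together with the `4` in the tail bound this gives the rate `L /
    -- 12`.
    have h2 : 1 / 3 ≤ √(1 - u) := Real.le_sqrt_of_sq_le (by linarith)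
    have h3 : L * (√(n * u) * √(1 - u)) / (4 * √(n * u)) = L * √(1 - u) / 4 := by
      field_simp
    rw [h3]
    nlinarith

/-- Since `24 = 2 · 12`, each threshold contributes at most `exp (1/4) / n²`, and there are at most
`n` thresholds. -/
lemma real_le_hcRank_null {n : ℕ} (hn : 4 ≤ n) :
    (Measure.pi fun _ : Fin n => (gaussianReal 0 1).prod (gaussianReal 0 1)).real
      {s | 24 * Real.log n ≤ hcRank s} ≤ Real.exp (1 / 4) / n := by
  have hn0 : (0 : ℝ) < n := by positivity
  have hlog : 0 ≤ Real.log n := Real.log_natCast_nonneg n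
  have hsub : {s : Fin n → ℝ × ℝ | 24 * Real.log n ≤ hcRank s}
      ⊆ ⋃ t ∈ Finset.range (n / 2 + 1), {s | 24 * Real.log n ≤ standardizedCount s t} := by
    intro s hs
    obtain ⟨t, ht, h⟩ := exists_le_standardizedCount hs
    simp only [Set.mem_iUnion]
    exact ⟨t, by simpa using Nat.lt_succ_of_le ht, h⟩
  have hexp : Real.exp (1 / 4 - 24 * Real.log n / 12) = Real.exp (1 / 4) / n ^ 2 := by
    rw [Real.exp_sub]
    congr 1
    rw [show 24 * Real.log n / 12 = ((2 : ℕ) : ℝ) * Real.log n by push_cast; ring, Real.exp_nat_mul,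
      Real.exp_log hn0]
  calc _ ≤ _ := measureReal_mono hsub (measure_ne_top _ _)
    _ ≤ _ := measureReal_biUnion_finset_le _ _
    _ ≤ ∑ t ∈ Finset.range (n / 2 + 1), Real.exp (1 / 4) / n ^ 2 := by
        refine Finset.sum_le_sum fun t ht => ?_
        rw [← hexp]
        exact real_le_standardizedCount hn (by simpa [Nat.lt_succ_iff] using ht) (by linarith)
    _ = ((n / 2 + 1 : ℕ) : ℝ) * (Real.exp (1 / 4) / n ^ 2) := by simp
    _ ≤ n * (Real.exp (1 / 4) / n ^ 2) := by
        refine mul_le_mul_of_nonneg_right ?_ (by positivity)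
        have : n / 2 + 1 ≤ n := by omega
        exact_mod_cast this
    _ = _ := by
        field_simp

lemma real_sampleLaw_hcRank {F G : ℝ → ℝ} {ε ρ : ℝ} {Q : Measure (ℝ × ℝ)}
    (h : IsGaussianMixtureCopula F G ε ρ Q) {n : ℕ} {B : Set ℝ} (hB : MeasurableSet B) :
    (sampleLaw n Q).real (hcRank ⁻¹' B)
      = (Measure.pi fun _ : Fin n => pairMixture ε (gaussianPair ρ)).real (hcRank ⁻¹' B) := by
  rw [← map_measureReal_apply measurable_hcRank hB, map_hcRank_sampleLaw h,
    map_measureReal_apply measurable_hcRank hB]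

/-- Under the null, the statistic is at most `24 log n` with probability tending to one. -/
theorem tendsto_real_le_hcRank_null {F G : ℕ → ℝ → ℝ} {ρ : ℕ → ℝ} {Q : ℕ → Measure (ℝ × ℝ)}
    (h : ∀ᶠ n in atTop, IsGaussianMixtureCopula (F n) (G n) 0 (ρ n) (Q n)) :
    Tendsto (fun n : ℕ => (sampleLaw n (Q n)).real {s | 24 * Real.log n ≤ hcRank s})
      atTop (𝓝 0) := by
  refine squeeze_zero' (Eventually.of_forall fun _ => measureReal_nonneg) ?_
    (tendsto_const_div_atTop_nhds_zero_nat (Real.exp (1 / 4)))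
  filter_upwards [h, eventually_ge_atTop 4] with n hn hn4
  have e := real_sampleLaw_hcRank hn (n := n) (measurableSet_Ici (a := 24 * Real.log n))
  simp only [pairMixture, sub_zero, ENNReal.ofReal_one, one_smul, ENNReal.ofReal_zero, zero_smul,
    add_zero] at e
  exact e.trans_le (real_le_hcRank_null hn4)

/-! ### Rank differences of a single observation -/

/-- The second moment of a sum of independent variables bounded by one. -/
lemma integral_sq_sum_pi_le {α : Type*} [MeasurableSpace α] (μ : Measure α) [IsProbabilityMeasure μ]
    {Y : α → ℝ} (hY : Measurable Y) (hb : ∀ x, |Y x| ≤ 1) (m : ℕ) :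
    ∫ x, (∑ j, Y (x j)) ^ 2 ∂(Measure.pi fun _ : Fin m => μ) ≤ m + (m * ∫ x, Y x ∂μ) ^ 2 := by
  have hL : MemLp Y 2 μ := MemLp.of_bound hY.aestronglyMeasurable 1 (ae_of_all _ hb)
  have hLi : ∀ j : Fin m, MemLp (fun x : Fin m → α => Y (x j)) 2 (Measure.pi fun _ : Fin m => μ) :=
    fun j => hL.comp_measurePreserving (measurePreserving_eval (fun _ : Fin m => μ) j)
  have hvar := variance_sum_pi (μ := fun _ : Fin m => μ) (X := fun _ => Y) fun _ => hL
  have hmean : ∫ x, (∑ j, fun x : Fin m → α => Y (x j)) x ∂(Measure.pi fun _ : Fin m => μ)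
      = m * ∫ x, Y x ∂μ := by
    simp only [Finset.sum_apply]
    rw [integral_finsetSum _ fun j _ => (hLi j).integrable (by norm_num)]
    have : ∀ j : Fin m, ∫ x : Fin m → α, Y (x j) ∂(Measure.pi fun _ : Fin m => μ)
        = ∫ x, Y x ∂μ := by
      intro j
      have h := (measurePreserving_eval (fun _ : Fin m => μ) j).map_eq
      conv_rhs => rw [← h]
      rw [integral_map (measurable_pi_apply j).aemeasurable hY.aestronglyMeasurable]
    simp [this]
  rw [variance_eq_sub (memLp_finsetSum' _ fun j _ => hLi j), hmean] at hvar
  have hv1 : Var[Y; μ] ≤ 1 := by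
    have := variance_le_sq_of_bounded (μ := μ) (X := Y) (a := -1) (b := 1)
      (ae_of_all _ fun x => abs_le.1 (hb x)) hY.aemeasurable
    norm_num at this
    exact this
  have hsum : ∑ _ : Fin m, Var[Y; μ] ≤ m := by
    simp only [Finset.sum_const, Finset.card_univ, Fintype.card_fin, nsmul_eq_mul]
    nlinarith [Nat.cast_nonneg (α := ℝ) m]
  have e : ∫ x, (∑ j, Y (x j)) ^ 2 ∂(Measure.pi fun _ : Fin m => μ)
      = ∫ x, ((∑ j, fun x : Fin m → α => Y (x j)) ^ 2) x ∂(Measure.pi fun _ : Fin m => μ) := by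
    simp
  rw [e]
  linarith

/-- The comparison of `z'` with `z` in the first coordinate minus that in the second. -/
def rankKernel (z z' : ℝ × ℝ) : ℝ :=
  (if z'.1 ≤ z.1 then 1 else 0) - (if z'.2 ≤ z.2 then 1 else 0)

lemma measurable_rankKernel : Measurable fun p : (ℝ × ℝ) × (ℝ × ℝ) => rankKernel p.1 p.2 := by
  unfold rankKernel
  refine Measurable.sub ?_ ?_
  · exact Measurable.ite (measurableSet_le (by fun_prop) (by fun_prop)) measurable_const
      measurable_const
  · exact Measurable.ite (measurableSet_le (by fun_prop) (by fun_prop)) measurable_const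
      measurable_const

lemma abs_rankKernel_le (z z' : ℝ × ℝ) : |rankKernel z z'| ≤ 1 := by
  unfold rankKernel
  split_ifs <;> norm_num

/-- Only the two marginals enter, each comparison having probability `Φ` of its threshold. The map
`f` leaves room for labelled observations, from which the pair is extracted by `select`. -/
lemma integral_rankKernel {α : Type*} [MeasurableSpace α] {μ : Measure α} [IsProbabilityMeasure μ]
    {f : α → ℝ × ℝ} (h₁ : MeasurePreserving (fun x => (f x).1) μ (gaussianReal 0 1))
    (h₂ : MeasurePreserving (fun x => (f x).2) μ (gaussianReal 0 1)) (z : ℝ × ℝ) :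
    ∫ x, rankKernel z (f x) ∂μ = stdNormalCDF z.1 - stdNormalCDF z.2 := by
  have key : ∀ {g : α → ℝ} (_ : MeasurePreserving g μ (gaussianReal 0 1)) (c : ℝ),
      Integrable (fun x => if g x ≤ c then (1 : ℝ) else 0) μ ∧
        ∫ x, (if g x ≤ c then (1 : ℝ) else 0) ∂μ = stdNormalCDF c := by
    intro g hg c
    have hm : MeasurableSet (g ⁻¹' Set.Iic c) := hg.measurable measurableSet_Iic
    have e : (fun x => if g x ≤ c then (1 : ℝ) else 0)
        = (g ⁻¹' Set.Iic c).indicator fun _ => 1 := by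
      ext x
      by_cases hx : g x ≤ c
      · rw [if_pos hx]
        exact (Set.indicator_of_mem (show x ∈ g ⁻¹' Set.Iic c from hx) fun _ => (1 : ℝ)).symm
      · rw [if_neg hx]
        exact (Set.indicator_of_notMem (show x ∉ g ⁻¹' Set.Iic c from hx) fun _ => (1 : ℝ)).symm
    rw [e]
    refine ⟨(integrable_const 1).indicator hm, ?_⟩
    rw [integral_indicator_const _ hm, smul_eq_mul, mul_one, stdNormalCDF, cdf_eq_real]
    exact hg.measureReal_preimage measurableSet_Iic.nullMeasurableSet
  unfold rankKernel
  rw [integral_sub (key h₁ z.1).1 (key h₂ z.2).1, (key h₁ z.1).2, (key h₂ z.2).2]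

lemma rankDiff_eq_abs_sum {n : ℕ} (s : Fin n → ℝ × ℝ) (i : Fin n) :
    (rankDiff s i : ℝ) = |∑ j, rankKernel (s i) (s j)| := by
  rw [rankDiff, Nat.cast_natAbs]
  push_cast
  congr 1
  simp only [rankKernel, Finset.sum_sub_distrib, Finset.sum_boole, rank]

/-- The probability of a large rank difference for an observation in `B` is bounded by the
integral over `B` of the conditional second moment of the rank difference. -/
lemma measure_rankDiff_le {α : Type*} [MeasurableSpace α] {μ : Measure α} [IsProbabilityMeasure μ]
    {f : α → ℝ × ℝ} (hf : Measurable f)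
    (h₁ : MeasurePreserving (fun x => (f x).1) μ (gaussianReal 0 1))
    (h₂ : MeasurePreserving (fun x => (f x).2) μ (gaussianReal 0 1))
    {B : Set α} (hB : MeasurableSet B) {n : ℕ} (i : Fin n) (t : ℕ) :
    Measure.pi (fun _ : Fin n => μ) {e | e i ∈ B ∧ t < rankDiff (fun j => f (e j)) i}
      ≤ ∫⁻ x in B, ENNReal.ofReal
        ((n + (n * (stdNormalCDF (f x).1 - stdNormalCDF (f x).2)) ^ 2) / (t + 1) ^ 2) ∂μ := by
  -- Observation `i` is split off: given its value, the rank difference is a sum over the other `m`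
  -- independent observations, the term of `i` itself being zero. Markov's inequality for the square
  -- then applies, with `t + 1` because `t < D_i` is an inequality of integers.
  obtain ⟨m, rfl⟩ : ∃ m, n = m + 1 := ⟨n - 1, by have := i.pos; omega⟩
  set A : Set (α × (Fin m → α)) :=
    {p | p.1 ∈ B ∧ ((t : ℝ) + 1) ^ 2 ≤ (∑ j, rankKernel (f p.1) (f (p.2 j))) ^ 2} with hA
  have hAm : MeasurableSet A := by
    have h : Measurable fun p : α × (Fin m → α) =>
        (∑ j, rankKernel (f p.1) (f (p.2 j))) ^ 2 := by
      refine (Finset.measurable_sum _ fun j _ => ?_).pow_const 2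
      exact measurable_rankKernel.comp ((hf.comp measurable_fst).prodMk
        (hf.comp ((measurable_pi_apply j).comp measurable_snd)))
    exact (measurable_fst hB).inter (measurableSet_le measurable_const h)
  have hMP := measurePreserving_piFinSuccAbove (fun _ : Fin (m + 1) => μ) i
  have hsub : {e : Fin (m + 1) → α | e i ∈ B ∧ t < rankDiff (fun j => f (e j)) i}
      ⊆ MeasurableEquiv.piFinSuccAbove (fun _ => α) i ⁻¹' A := by
    rintro e ⟨he, ht⟩
    refine ⟨he, ?_⟩
    have h1 : ((t : ℝ) + 1) ≤ rankDiff (fun j => f (e j)) i := by exact_mod_cast ht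
    have h2 := rankDiff_eq_abs_sum (fun j => f (e j)) i
    rw [Fin.sum_univ_succAbove _ i] at h2
    have h3 : rankKernel (f (e i)) (f (e i)) = 0 := by simp [rankKernel]
    rw [h3, zero_add] at h2
    rw [h2] at h1
    rw [← sq_abs (∑ j, _)]
    exact pow_le_pow_left₀ (by positivity) h1 2
  refine (measure_mono hsub).trans ?_
  rw [hMP.measure_preimage hAm.nullMeasurableSet, Measure.prod_apply hAm,
    ← lintegral_indicator hB]
  refine lintegral_mono fun x => ?_
  by_cases hx : x ∈ B
  swap
  · have : Prod.mk x ⁻¹' A = ∅ := by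
      ext y
      simp [hA, hx]
    simp only [this, measure_empty]
    exact zero_le
  simp only [Set.indicator_of_mem hx]
  set c := stdNormalCDF (f x).1 - stdNormalCDF (f x).2 with hc
  have hYm : Measurable fun x' => rankKernel (f x) (f x') :=
    measurable_rankKernel.comp (measurable_const.prodMk hf)
  have hmom := integral_sq_sum_pi_le μ hYm (fun _ => abs_rankKernel_le _ _) m
  rw [integral_rankKernel h₁ h₂] at hmom
  have hint : Integrable (fun y : Fin m → α => (∑ j, rankKernel (f x) (f (y j))) ^ 2)
      (Measure.pi fun _ => μ) := by
    refine Integrable.of_bound (C := (m : ℝ) ^ 2) ?_ (ae_of_all _ fun y => ?_)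
    · exact ((Finset.measurable_sum _ fun j _ =>
        hYm.comp (measurable_pi_apply j)).pow_const 2).aestronglyMeasurable
    · rw [Real.norm_eq_abs, abs_pow]
      refine pow_le_pow_left₀ (abs_nonneg _) ?_ 2
      refine (Finset.abs_sum_le_sum_abs _ _).trans ?_
      refine (Finset.sum_le_sum fun j _ => abs_rankKernel_le (f x) (f (y j))).trans_eq ?_
      simp
  have hmk := mul_meas_ge_le_integral_of_nonneg (ae_of_all _ fun y => sq_nonneg _) hint
    (((t : ℝ) + 1) ^ 2)
  have hpre : Prod.mk x ⁻¹' A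
      = {y | ((t : ℝ) + 1) ^ 2 ≤ (∑ j, rankKernel (f x) (f (y j))) ^ 2} := by
    ext y
    simp [hA, hx]
  rw [← ENNReal.ofReal_toReal (measure_ne_top (Measure.pi fun _ => μ) (Prod.mk x ⁻¹' A))]
  refine ENNReal.ofReal_le_ofReal ?_
  rw [le_div_iff₀ (by positivity), hpre, mul_comm]
  refine (hmk.trans hmom).trans ?_
  push_cast
  have hm0 : (0 : ℝ) ≤ m := by positivity
  rw [mul_pow, mul_pow]
  nlinarith [mul_nonneg hm0 (sq_nonneg c), sq_nonneg c]

/-! ### A representation of the mixture by labelled observations -/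

/-- The law of the label of an observation. -/
def labelLaw (ε : ℝ) : Measure Bool :=
  ENNReal.ofReal (1 - ε) • Measure.dirac false + ENNReal.ofReal ε • Measure.dirac true

/-- The law of `((b, (x, w)), y)` where the label `b`, the standard normal variables `x` and `y`
and the pair `w ∼ κ` are independent. -/
def labelledLaw (ε : ℝ) (κ : Measure (ℝ × ℝ)) : Measure ((Bool × (ℝ × (ℝ × ℝ))) × ℝ) :=
  ((labelLaw ε).prod ((gaussianReal 0 1).prod κ)).prod (gaussianReal 0 1)

/-- The pair `w` if the label is `true`, and the pair `(x, y)` otherwise. -/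
def select (e : (Bool × (ℝ × (ℝ × ℝ))) × ℝ) : ℝ × ℝ :=
  if e.1.1 = true then e.1.2.2 else (e.1.2.1, e.2)

lemma measurable_select : Measurable select := by
  unfold select
  refine Measurable.ite ?_ (by fun_prop) (by fun_prop)
  exact measurable_fst.fst (measurableSet_singleton true)

lemma measurableSet_label :
    MeasurableSet {e : (Bool × (ℝ × (ℝ × ℝ))) × ℝ | e.1.1 = true} :=
  measurable_fst.fst (measurableSet_singleton true)

lemma lintegral_labelledLaw {ε : ℝ} {κ : Measure (ℝ × ℝ)} [IsProbabilityMeasure κ]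
    {f : (Bool × (ℝ × (ℝ × ℝ))) × ℝ → ENNReal} (hf : Measurable f) :
    ∫⁻ e, f e ∂labelledLaw ε κ
      = ENNReal.ofReal (1 - ε) * ∫⁻ p, f ((false, p.1), p.2)
          ∂(((gaussianReal 0 1).prod κ).prod (gaussianReal 0 1))
        + ENNReal.ofReal ε * ∫⁻ p, f ((true, p.1), p.2)
          ∂(((gaussianReal 0 1).prod κ).prod (gaussianReal 0 1)) := by
  have : IsFiniteMeasure (labelLaw ε) := ⟨by simp [labelLaw]⟩
  have hprod : ∀ b : Bool, Measurable fun p : (ℝ × (ℝ × ℝ)) × ℝ => f ((b, p.1), p.2) := fun b =>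
    hf.comp (by fun_prop)
  rw [labelledLaw, lintegral_prod _ hf.aemeasurable, lintegral_prod, labelLaw,
    lintegral_add_measure, lintegral_smul_measure, lintegral_smul_measure, lintegral_dirac,
    lintegral_dirac, lintegral_prod _ (hprod false).aemeasurable,
    lintegral_prod _ (hprod true).aemeasurable]
  · rfl
  · exact hf.lintegral_prod_right'.aemeasurable

lemma map_select_labelledLaw (ε : ℝ) (κ : Measure (ℝ × ℝ)) [IsProbabilityMeasure κ] :
    (labelledLaw ε κ).map select = pairMixture ε κ := by
  refine Measure.ext_of_lintegral _ fun f hf => ?_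
  have hf' : Measurable fun e => f (select e) := hf.comp measurable_select
  rw [lintegral_map hf measurable_select, lintegral_labelledLaw hf',
    pairMixture, lintegral_add_measure, lintegral_smul_measure, lintegral_smul_measure]
  have h1 : MeasurePreserving (fun p : (ℝ × (ℝ × ℝ)) × ℝ => (p.1.1, p.2))
      (((gaussianReal 0 1).prod κ).prod (gaussianReal 0 1))
      ((gaussianReal 0 1).prod (gaussianReal 0 1)) :=
    measurePreserving_fst.prod (MeasurePreserving.id _)
  have h2 : MeasurePreserving (fun p : (ℝ × (ℝ × ℝ)) × ℝ => p.1.2)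
      (((gaussianReal 0 1).prod κ).prod (gaussianReal 0 1)) κ :=
    measurePreserving_snd.comp measurePreserving_fst
  rw [← h1.lintegral_comp hf, ← h2.lintegral_comp hf]
  simp [select]

/-- The label is independent of `w`, and `select` returns `w` on contaminated observations. -/
lemma setLIntegral_label {ε : ℝ} {κ : Measure (ℝ × ℝ)} [IsProbabilityMeasure κ]
    {f : ℝ × ℝ → ENNReal} (hf : Measurable f) :
    ∫⁻ e in {e | e.1.1 = true}, f (select e) ∂labelledLaw ε κ
      = ENNReal.ofReal ε * ∫⁻ w, f w ∂κ := by
  have hf' : Measurable fun e => f (select e) := hf.comp measurable_select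
  rw [← lintegral_indicator measurableSet_label,
    lintegral_labelledLaw (hf'.indicator measurableSet_label)]
  have h2 : MeasurePreserving (fun p : (ℝ × (ℝ × ℝ)) × ℝ => p.1.2)
      (((gaussianReal 0 1).prod κ).prod (gaussianReal 0 1)) κ :=
    measurePreserving_snd.comp measurePreserving_fst
  rw [← h2.lintegral_comp hf]
  simp [select]

lemma labelledLaw_label (ε : ℝ) (κ : Measure (ℝ × ℝ)) [IsProbabilityMeasure κ] :
    labelledLaw ε κ {e | e.1.1 = true} = ENNReal.ofReal ε := by
  have := setLIntegral_label (ε := ε) (κ := κ) (f := fun _ => 1) measurable_const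
  simpa using this

lemma isProbabilityMeasure_labelLaw {ε : ℝ} (h0 : 0 ≤ ε) (h1 : ε ≤ 1) :
    IsProbabilityMeasure (labelLaw ε) :=
  isProbabilityMeasure_smul_add_smul h0 h1

lemma isProbabilityMeasure_labelledLaw {ε : ℝ} (h0 : 0 ≤ ε) (h1 : ε ≤ 1) (κ : Measure (ℝ × ℝ))
    [IsProbabilityMeasure κ] : IsProbabilityMeasure (labelledLaw ε κ) := by
  have := isProbabilityMeasure_labelLaw h0 h1
  unfold labelledLaw
  infer_instance

/-! ### The alternative hypothesis -/

/-- Restricting the matrix of a rank-difference count to the observations satisfying `p` changes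
its mean by little when few observations are left out. -/
lemma permMean_near_subtype {n t : ℕ} (hn : 4 ≤ n) (ht : t ≤ n / 2) {x y : Fin n → ℝ}
    (hx : Function.Injective x) (hy : Function.Injective y) (p : Fin n → Prop) [DecidablePred p]
    {K : ℕ} (hK : K = (Finset.univ.filter fun i => ¬ p i).card) (hK2 : 2 * K ≤ n) :
    n * nullProb n t - K * (4 * (2 * t + 1) / n)
        ≤ permMean (fun i j : {i // p i} => near t (rank x i) (rank y j)) ∧
      2 * permMean (fun i j : {i // p i} => near t (rank x i) (rank y j)) ≤ 4 * (2 * t + 1) := by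
  obtain ⟨hu1, hu2, -, -⟩ := nullProb_bounds hn ht
  set v := n * nullProb n t
  have hn0 : (0 : ℝ) < n := by positivity
  have hK2' : 2 * (K : ℝ) ≤ n := by exact_mod_cast hK2
  have hcard : (Fintype.card {i // p i} : ℝ) = n - K := by
    have h := Finset.card_filter_add_card_filter_not (s := (Finset.univ : Finset (Fin n))) p
    rw [← hK, Finset.card_univ, Fintype.card_fin] at h
    have h' : ((Finset.univ.filter p).card : ℝ) + K = n := by exact_mod_cast h
    rw [Fintype.card_subtype]
    linarith
  have hsub : ∀ f : Fin n → ℝ, ∑ i : {i // p i}, f i = ∑ i ∈ Finset.univ.filter p, f i :=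
    fun f => (Finset.sum_subtype _ (by simp) f).symm
  set T := ∑ i ∈ Finset.univ.filter p, ∑ j ∈ Finset.univ.filter p, near t (rank x i) (rank y j)
    with hT
  have hmean : permMean (fun i j : {i // p i} => near t (rank x i) (rank y j)) = T / (n - K) := by
    rw [permMean, hcard]
    congr 1
    rw [hT, ← hsub]
    exact Finset.sum_congr rfl fun i _ => hsub fun j => near t (rank x i) (rank y j)
  have htot := sum_sum_near_rank (n := n) (t := t) (by omega) hx hy
  have hsplit : n * v = T
      + ∑ i ∈ Finset.univ.filter p, ∑ j ∈ Finset.univ.filter (fun i => ¬ p i),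
          near t (rank x i) (rank y j)
      + ∑ i ∈ Finset.univ.filter (fun i => ¬ p i), ∑ j, near t (rank x i) (rank y j) := by
    rw [← htot, ← Finset.sum_filter_add_sum_filter_not Finset.univ p, hT, ← Finset.sum_add_distrib]
    congr 1
    exact Finset.sum_congr rfl fun i _ => (Finset.sum_filter_add_sum_filter_not _ p _).symm
  have hB : ∑ i ∈ Finset.univ.filter p, ∑ j ∈ Finset.univ.filter (fun i => ¬ p i),
      near t (rank x i) (rank y j) ≤ K * (2 * t + 1) := by
    rw [Finset.sum_comm, hK, ← nsmul_eq_mul, ← Finset.sum_const]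
    refine Finset.sum_le_sum fun j _ => ?_
    refine (Finset.sum_le_sum_of_subset_of_nonneg (Finset.subset_univ _)
      fun i _ _ => near_nonneg _ _ _).trans ?_
    simp only [near_comm t _ (rank y j)]
    exact sum_near_rank_le hx t _ (rank_pos y j)
  have hC : ∑ i ∈ Finset.univ.filter (fun i => ¬ p i), ∑ j, near t (rank x i) (rank y j)
      ≤ K * (2 * t + 1) := by
    rw [hK, ← nsmul_eq_mul, ← Finset.sum_const]
    exact Finset.sum_le_sum fun i _ => sum_near_rank_le hy t _ (rank_pos x i)
  have hB0 : 0 ≤ ∑ i ∈ Finset.univ.filter p, ∑ j ∈ Finset.univ.filter (fun i => ¬ p i),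
      near t (rank x i) (rank y j) :=
    Finset.sum_nonneg fun i _ => Finset.sum_nonneg fun j _ => near_nonneg _ _ _
  have hC0 : 0 ≤ ∑ i ∈ Finset.univ.filter (fun i => ¬ p i), ∑ j, near t (rank x i) (rank y j) :=
    Finset.sum_nonneg fun i _ => Finset.sum_nonneg fun j _ => near_nonneg _ _ _
  have hpos : (0 : ℝ) < n - K := by linarith
  have ht0 : (0 : ℝ) ≤ 2 * t + 1 := by positivity
  have hK0 : (0 : ℝ) ≤ K := by positivity
  rw [hmean]
  constructor
  · rw [le_div_iff₀ hpos]
    -- The `K` deleted rows and `K` deleted columns contain at most `2t + 1` ones each; dividing by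
    -- `n - K ≥ n/2` rather than `n` accounts for the factor `4`.
    have h1 : K * (4 * (2 * (t : ℝ) + 1) / n) * (n - K) ≥ 2 * (K * (2 * t + 1)) := by
      rw [mul_div_assoc', div_mul_eq_mul_div, ge_iff_le, le_div_iff₀ hn0]
      nlinarith [mul_nonneg (mul_nonneg hK0 ht0) (show (0 : ℝ) ≤ n - 2 * K by linarith)]
    nlinarith [mul_nonneg hK0 (show (0 : ℝ) ≤ v by linarith)]
  · rw [mul_div_assoc', div_le_iff₀ hpos]
    nlinarith

/-- The data from which the latent pairs are selected. -/
abbrev Labelled := (Bool × (ℝ × (ℝ × ℝ))) × ℝ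

/-- The number of contaminated observations. -/
def contaminatedCard {n : ℕ} (e : Fin n → Labelled) : ℕ :=
  (Finset.univ.filter fun i => (e i).1.1 = true).card

/-- The number of uncontaminated observations with rank difference at most `t`. -/
def cleanCount {n : ℕ} (t : ℕ) (e : Fin n → Labelled) : ℝ :=
  ∑ i, if (e i).1.1 = true then 0 else
    near t (rank (fun j => (select (e j)).1) i) (rank (fun j => (select (e j)).2) i)

lemma measurableSet_label_eval {n : ℕ} (i : Fin n) :
    MeasurableSet {e : Fin n → Labelled | (e i).1.1 = true} :=
  (measurable_pi_apply (X := fun _ => Labelled) i) measurableSet_label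

lemma measurable_contaminatedCard {n : ℕ} :
    Measurable (contaminatedCard (n := n)) := by
  have : contaminatedCard (n := n) = fun e => ∑ i, if (e i).1.1 = true then 1 else 0 := by
    ext e
    rw [contaminatedCard, Finset.card_filter]
  rw [this]
  exact Finset.measurable_sum _ fun i _ =>
    Measurable.ite (measurableSet_label_eval i) measurable_const measurable_const

lemma measurable_select_eval {n : ℕ} :
    Measurable fun (e : Fin n → Labelled) i => select (e i) :=
  measurable_pi_lambda _ fun i => measurable_select.comp (measurable_pi_apply i)

lemma measurable_cleanCount {n : ℕ} (t : ℕ) : Measurable (cleanCount (n := n) t) := by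
  refine Finset.measurable_sum _ fun i _ => ?_
  refine Measurable.ite (measurableSet_label_eval i) measurable_const ?_
  have hs : ∀ j : Fin n, Measurable fun e : Fin n → Labelled => select (e j) :=
    fun j => measurable_select.comp (measurable_pi_apply j)
  exact (measurable_of_countable fun p : ℕ × ℕ => near t p.1 p.2).comp
    ((measurable_rank (fun j => (hs j).fst) i).prodMk (measurable_rank (fun j => (hs j).snd) i))

/-- With high probability, the uncontaminated observations contribute to the count almost as much
as the whole sample would under the null. -/
lemma real_cleanCount_le {n t : ℕ} (hn : 4 ≤ n) (ht : t ≤ n / 2) {ε : ℝ} (h0 : 0 ≤ ε) (h1 : ε ≤ 1)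
    {κ : Measure (ℝ × ℝ)} [IsProbabilityMeasure κ]
    (hκ₁ : MeasurePreserving Prod.fst κ (gaussianReal 0 1))
    (hκ₂ : MeasurePreserving Prod.snd κ (gaussianReal 0 1)) {x : ℝ} (hx : 0 < x) :
    (Measure.pi fun _ : Fin n => labelledLaw ε κ).real {e | 2 * contaminatedCard e ≤ n ∧
        cleanCount t e ≤ n * nullProb n t - contaminatedCard e * (4 * (2 * t + 1) / n) - x}
      ≤ 4 * (2 * t + 1) / x ^ 2 := by
  classical
  have := isProbabilityMeasure_labelledLaw h0 h1 κ
  have := isProbabilityMeasure_labelLaw h0 h1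
  have := isProbabilityMeasure_pairMixture h0 h1 κ
  set η := (labelLaw ε).prod ((gaussianReal 0 1).prod κ) with hη
  have hMP : MeasurePreserving
      (MeasurableEquiv.arrowProdEquivProdArrow (Bool × (ℝ × (ℝ × ℝ))) ℝ (Fin n))
      (Measure.pi fun _ => labelledLaw ε κ)
      ((Measure.pi fun _ => η).prod (Measure.pi fun _ => gaussianReal 0 1)) :=
    measurePreserving_arrowProdEquivProdArrow _ ℝ (Fin n) (fun _ => η) (fun _ => gaussianReal 0 1)
  have hMPs := hMP.symm
  let join : (Fin n → Bool × (ℝ × (ℝ × ℝ))) × (Fin n → ℝ) → Fin n → Labelled :=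
    fun q i => (q.1 i, q.2 i)
  have hjoin : Measurable join := by
    refine measurable_pi_lambda _ fun i => ?_
    fun_prop
  set A : Set ((Fin n → Bool × (ℝ × (ℝ × ℝ))) × (Fin n → ℝ)) :=
    {q | 2 * contaminatedCard (join q) ≤ n ∧ cleanCount t (join q) ≤ n * nullProb n t
      - contaminatedCard (join q) * (4 * (2 * t + 1) / n) - x} with hAdef
  have hA : MeasurableSet A := by
    have hK := measurable_contaminatedCard.comp hjoin
    have hK' : Measurable fun q => (contaminatedCard (join q) : ℝ) :=
      (measurable_of_countable fun k : ℕ => (k : ℝ)).comp hK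
    refine MeasurableSet.inter ?_ ?_
    · exact measurableSet_le (hK.const_mul 2) measurable_const
    · exact measurableSet_le ((measurable_cleanCount t).comp hjoin)
        (((hK'.mul_const _).const_sub _).sub_const _)
  have hsel : MeasurePreserving select (labelledLaw ε κ) (pairMixture ε κ) :=
    ⟨measurable_select, map_select_labelledLaw ε κ⟩
  have hfst := ae_injective_comp_pi (n := n) ((measurePreserving_fst_pairMixture h0 h1 hκ₁).comp hsel)
  have hsnd := ae_injective_comp_pi (n := n) ((measurePreserving_snd_pairMixture h0 h1 hκ₂).comp hsel)
  have hgen := Measure.ae_ae_of_ae_prod (hMPs.quasiMeasurePreserving.ae (hfst.and hsnd))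
  have hδ : 0 ≤ 4 * (2 * (t : ℝ) + 1) / x ^ 2 := by positivity
  refine le_trans (le_of_eq ?_) (real_prod_le (μ := Measure.pi fun _ : Fin n => η)
    (ν := Measure.pi fun _ : Fin n => gaussianReal 0 1) hA hδ ?_)
  · exact hMP.measureReal_preimage hA.nullMeasurableSet
  filter_upwards [hgen] with c hc
  have hAc : MeasurableSet (Prod.mk c ⁻¹' A) := measurable_prodMk_left hA
  let p : Fin n → Prop := fun i => ¬ (c i).1 = true
  -- Only `y` is random here; labels, first coordinates and contaminated pairs are frozen in `c`.
  -- Permutations fixing the contaminated indices preserve the law of `y`, and they permute the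
  -- second coordinates of the selected pairs without changing the first ones.
  let g : Equiv.Perm {i // p i} → Equiv.Perm (Fin n) := fun σ => Equiv.Perm.ofSubtype σ
  refine real_le_of_card_perm_le (gaussianReal 0 1) g hAc ?_
  filter_upwards [hc] with y hy
  set X : Fin n → ℝ := fun j => (select (c j, y j)).1 with hX
  set Y : Fin n → ℝ := fun j => (select (c j, y j)).2 with hY
  have hXi : Function.Injective X := hy.1
  have hYi : Function.Injective Y := hy.2
  have hXg : ∀ σ, (fun j => (select (join (c, fun i => y (g σ i)) j)).1) = X := by
    intro σ
    ext j
    simp only [join, select, hX]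
    split_ifs <;> rfl
  have hYg : ∀ σ, (fun j => (select (join (c, fun i => y (g σ i)) j)).2) = fun j => Y (g σ j) := by
    intro σ
    ext j
    simp only [join, select, hY]
    by_cases hj : (c j).1 = true
    · have : g σ j = j := Equiv.Perm.ofSubtype_apply_of_not_mem σ (by simpa [p] using hj)
      simp [this, hj]
    · have h2 : g σ j = (σ ⟨j, hj⟩ : Fin n) := Equiv.Perm.ofSubtype_apply_of_mem σ hj
      have h3 : ¬ (c (g σ j)).1 = true := by
        rw [h2]
        exact (σ ⟨j, hj⟩).2
      rw [if_neg hj, if_neg h3]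
  set a : {i // p i} → {i // p i} → ℝ := fun i j => near t (rank X i) (rank Y j) with ha
  have hclean : ∀ σ, cleanCount t (join (c, fun i => y (g σ i))) = permStat a σ := by
    intro σ
    rw [cleanCount, hXg, hYg, permStat]
    have h2 : ∀ i : {i // p i}, a i (σ i) = near t (rank X i) (rank Y (g σ i)) := by
      intro i
      rw [show g σ i = (σ i : Fin n) from Equiv.Perm.ofSubtype_apply_coe σ i]
    rw [Finset.sum_congr rfl fun i _ => h2 i,
      ← Finset.sum_subtype (Finset.univ.filter p) (by simp)
        fun i => near t (rank X i) (rank Y (g σ i)), Finset.sum_filter]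
    refine Finset.sum_congr rfl fun i _ => ?_
    rw [rank_comp_perm]
    by_cases hi : (c i).1 = true
    · rw [if_pos (show (join (c, fun i => y (g σ i)) i).1.1 = true from hi),
        if_neg (show ¬ p i from not_not.2 hi)]
    · rw [if_neg (show ¬ (join (c, fun i => y (g σ i)) i).1.1 = true from hi), if_pos hi]
  set K := (Finset.univ.filter fun i => ¬ p i).card with hK
  have hKg : ∀ σ, contaminatedCard (join (c, fun i => y (g σ i))) = K := by
    intro σ
    simp [contaminatedCard, join, hK, p]
  -- If more than half of the observations are contaminated, no rearrangement lies in the event,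
  -- whose definition includes this bound.
  by_cases hK2 : 2 * K ≤ n
  swap
  · rw [Finset.card_eq_zero.2]
    · simpa using mul_nonneg (Nat.cast_nonneg (α := ℝ) _) hδ
    · refine Finset.filter_eq_empty_iff.2 fun σ _ hσ => hK2 ?_
      have := hσ.1
      rwa [hKg] at this
  obtain ⟨hm1, hm2⟩ := permMean_near_subtype hn ht hXi hYi p hK hK2
  have hne : Nonempty {i // p i} := by
    by_contra hcon
    have : ∀ i, ¬ p i := fun i hi => hcon ⟨⟨i, hi⟩⟩
    rw [Finset.filter_true_of_mem fun i _ => this i, Finset.card_univ, Fintype.card_fin] at hK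
    omega
  refine le_trans ?_ ((card_permStat_le_mean_sub (a := a)
    (fun i j => near_eq_zero_or_one _ _ _) hx).trans ?_)
  · refine Nat.cast_le.2 (Finset.card_le_card fun σ hσ => ?_)
    have h2 := (Finset.mem_filter.1 hσ).2.2
    rw [hclean, hKg] at h2
    refine Finset.mem_filter.2 ⟨Finset.mem_univ _, h2.trans ?_⟩
    linarith
  · gcongr

/-- The number of contaminated observations concentrates around its mean. -/
lemma real_contaminatedCard_le (n : ℕ) {ε : ℝ} (h0 : 0 < ε) (h1 : ε ≤ 1) (hn : 0 < n)
    (κ : Measure (ℝ × ℝ)) [IsProbabilityMeasure κ] :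
    (Measure.pi fun _ : Fin n => labelledLaw ε κ).real
      {e | n * ε / 2 ≤ |(contaminatedCard e : ℝ) - n * ε|} ≤ 4 / (n * ε) := by
  have := isProbabilityMeasure_labelledLaw h0.le h1 κ
  set P := Measure.pi fun _ : Fin n => labelledLaw ε κ
  let f : Labelled → ℝ := {e : Labelled | e.1.1 = true}.indicator fun _ => 1
  have hf : Measurable f := measurable_const.indicator measurableSet_label
  have hf01 : ∀ e, f e = 0 ∨ f e = 1 := fun e => by
    by_cases he : e ∈ {e : Labelled | e.1.1 = true}
    · exact Or.inr (Set.indicator_of_mem he _)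
    · exact Or.inl (Set.indicator_of_notMem he _)
  have hfL : MemLp f 2 (labelledLaw ε κ) := by
    refine MemLp.of_bound hf.aestronglyMeasurable 1 (ae_of_all _ fun e => ?_)
    rcases hf01 e with h | h <;> simp [h]
  have hfint : ∫ e, f e ∂labelledLaw ε κ = ε := by
    rw [show f = {e : Labelled | e.1.1 = true}.indicator fun _ => (1 : ℝ) from rfl,
      integral_indicator_const _ measurableSet_label, measureReal_def, labelledLaw_label,
      ENNReal.toReal_ofReal h0.le, smul_eq_mul, mul_one]
  have hvar := variance_sum_pi (μ := fun _ : Fin n => labelledLaw ε κ) (X := fun _ => f)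
    fun _ => hfL
  have hfv : Var[f; labelledLaw ε κ] ≤ ε := by
    refine (variance_le_expectation_sq hf.aestronglyMeasurable).trans_eq (Eq.trans ?_ hfint)
    refine integral_congr_ae (ae_of_all _ fun e => ?_)
    rcases hf01 e with h | h <;> simp [h]
  have hLi : ∀ j : Fin n, MemLp (fun e : Fin n → Labelled => f (e j)) 2 P :=
    fun j => hfL.comp_measurePreserving (measurePreserving_eval (fun _ => labelledLaw ε κ) j)
  have hmean : ∫ e, (∑ j, fun e : Fin n → Labelled => f (e j)) e ∂P = n * ε := by
    simp only [Finset.sum_apply]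
    rw [integral_finsetSum _ fun j _ => (hLi j).integrable (by norm_num)]
    have : ∀ j : Fin n, ∫ e : Fin n → Labelled, f (e j) ∂P = ε := by
      intro j
      have h := (measurePreserving_eval (fun _ : Fin n => labelledLaw ε κ) j).map_eq
      refine Eq.trans ?_ hfint
      conv_rhs => rw [← h]
      rw [integral_map (measurable_pi_apply j).aemeasurable hf.aestronglyMeasurable]
    simp [this]
  have hcard : ∀ e : Fin n → Labelled,
      (∑ j, fun e : Fin n → Labelled => f (e j)) e = contaminatedCard e := by
    intro e
    rw [contaminatedCard, Finset.sum_apply, ← Finset.sum_boole]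
    refine Finset.sum_congr rfl fun i _ => ?_
    by_cases hi : (e i).1.1 = true
    · rw [if_pos hi]
      exact Set.indicator_of_mem (s := {e : Labelled | e.1.1 = true}) hi _
    · rw [if_neg hi]
      exact Set.indicator_of_notMem (s := {e : Labelled | e.1.1 = true}) hi _
  have hnε : 0 < n * ε := by positivity
  have hcheb := meas_ge_le_variance_div_sq (memLp_finsetSum' Finset.univ fun j _ => hLi j)
    (show 0 < n * ε / 2 by positivity)
  simp only [hmean] at hcheb
  simp only [hcard] at hcheb
  refine ENNReal.toReal_le_of_le_ofReal (by positivity)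
    (hcheb.trans (ENNReal.ofReal_le_ofReal ?_))
  rw [div_le_div_iff₀ (by positivity) hnε, hvar]
  simp only [Finset.sum_const, Finset.card_univ, Fintype.card_fin, nsmul_eq_mul]
  have : n * Var[f; labelledLaw ε κ] ≤ n * ε := by gcongr
  nlinarith

/-- Few contaminated observations have a large rank difference. -/
lemma real_contaminated_far_le {n : ℕ} (hn : 0 < n) (t : ℕ) {ε ρ : ℝ} (h0 : 0 < ε) (h1 : ε ≤ 1)
    (hρ0 : 0 ≤ ρ) (hρ1 : ρ ≤ 1) :
    (Measure.pi fun _ : Fin n => labelledLaw ε (gaussianPair ρ)).real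
      {e | n * ε / 8 ≤ ((Finset.univ.filter fun i =>
        (e i).1.1 = true ∧ t < rankDiff (fun j => select (e j)) i).card : ℝ)}
      ≤ 8 * (n + 2 * n ^ 2 * (1 - ρ)) / (t + 1) ^ 2 := by
  set κ := gaussianPair ρ
  have := isProbabilityMeasure_labelledLaw h0.le h1 κ
  have := isProbabilityMeasure_pairMixture h0.le h1 κ
  set P := Measure.pi fun _ : Fin n => labelledLaw ε κ
  have hsel : MeasurePreserving select (labelledLaw ε κ) (pairMixture ε κ) :=
    ⟨measurable_select, map_select_labelledLaw ε κ⟩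
  have hfst := (measurePreserving_fst_pairMixture h0.le h1
    (measurePreserving_fst_gaussianPair hρ0 hρ1)).comp hsel
  have hsnd := (measurePreserving_snd_pairMixture h0.le h1
    (measurePreserving_snd_gaussianPair hρ0 hρ1)).comp hsel
  have hn0 : (0 : ℝ) < n := by exact_mod_cast hn
  have hρ' : 0 ≤ 1 - ρ := by linarith
  set δ := (n + 2 * n ^ 2 * (1 - ρ)) / ((t : ℝ) + 1) ^ 2 with hδ
  have hδ0 : 0 ≤ δ := by positivity
  have hone : ∀ i : Fin n, P.real {e | (e i).1.1 = true ∧ t < rankDiff (fun j => select (e j)) i}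
      ≤ ε * δ := by
    intro i
    refine ENNReal.toReal_le_of_le_ofReal (by positivity) ?_
    -- Restricting to contaminated observations produces the factor `ε`; the Lipschitz bound on `Φ`
    -- then replaces the squared mean by `n² (w.1 - w.2)²`, whose expectation is `2 n² (1 - ρ)`.
    refine (measure_rankDiff_le (f := select) measurable_select hfst hsnd measurableSet_label i
      t).trans ?_
    rw [setLIntegral_label (f := fun w => ENNReal.ofReal
        ((n + (n * (stdNormalCDF w.1 - stdNormalCDF w.2)) ^ 2) / ((t : ℝ) + 1) ^ 2)),
      ENNReal.ofReal_mul h0.le]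
    swap
    · refine ENNReal.measurable_ofReal.comp (Measurable.div_const (Measurable.const_add
        ((Measurable.const_mul ?_ _).pow_const 2) _) _)
      exact (measurable_stdNormalCDF.comp measurable_fst).sub
        (measurable_stdNormalCDF.comp measurable_snd)
    refine mul_le_mul_right ?_ _
    have hint : Integrable (fun w : ℝ × ℝ => (n + n ^ 2 * (w.1 - w.2) ^ 2) / ((t : ℝ) + 1) ^ 2) κ :=
      ((integrable_const _).add ((integrable_sq_sub_gaussianPair ρ).const_mul _)).div_const _
    have hval : ∫ w : ℝ × ℝ, (n + n ^ 2 * (w.1 - w.2) ^ 2) / ((t : ℝ) + 1) ^ 2 ∂κ = δ := by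
      rw [integral_div, integral_add (integrable_const _)
        ((integrable_sq_sub_gaussianPair ρ).const_mul _), integral_const_mul,
        integral_sq_sub_gaussianPair hρ0 hρ1]
      simp [hδ]
      ring
    rw [← hval, ofReal_integral_eq_lintegral_ofReal hint
      (ae_of_all _ fun w => by positivity)]
    refine lintegral_mono fun w => ENNReal.ofReal_le_ofReal ?_
    rw [mul_pow]
    have := sq_le_sq' (neg_le_of_abs_le (abs_stdNormalCDF_sub_le w.1 w.2 |>.trans_eq rfl))
      (le_of_abs_le (abs_stdNormalCDF_sub_le w.1 w.2))
    rw [sq_abs] at this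
    gcongr
  have hm : ∀ i : Fin n,
      MeasurableSet {e : Fin n → Labelled | (e i).1.1 = true ∧ t < rankDiff (fun j => select (e j)) i} :=
    fun i => (measurableSet_label_eval i).inter (measurableSet_lt measurable_const
      ((measurable_rankDiff i).comp measurable_select_eval))
  have hint : ∀ i : Fin n, Integrable ({e : Fin n → Labelled |
      (e i).1.1 = true ∧ t < rankDiff (fun j => select (e j)) i}.indicator fun _ => (1 : ℝ)) P :=
    fun i => (integrable_const 1).indicator (hm i)
  -- Markov's inequality for the number of far contaminated observations: its mean is at most `n ε
  -- δ`, and the level `n ε / 8` gives `8 δ`.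
  have hmk := mul_meas_ge_le_integral_of_nonneg (μ := P) (f := fun e => ∑ i : Fin n,
    {e : Fin n → Labelled | (e i).1.1 = true ∧ t < rankDiff (fun j => select (e j)) i}.indicator
      (fun _ => (1 : ℝ)) e) (ae_of_all _ fun e => Finset.sum_nonneg fun i _ =>
        Set.indicator_nonneg (fun _ _ => zero_le_one) _) (integrable_finsetSum _ fun i _ => hint i)
    (n * ε / 8)
  rw [integral_finsetSum _ fun i _ => hint i] at hmk
  have hsum : ∑ i : Fin n, ∫ e, {e : Fin n → Labelled |
      (e i).1.1 = true ∧ t < rankDiff (fun j => select (e j)) i}.indicator (fun _ => (1 : ℝ)) e ∂P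
      ≤ n * (ε * δ) := by
    refine (Finset.sum_le_sum fun i _ => ?_).trans_eq (b := ∑ _ : Fin n, ε * δ) (by simp)
    rw [integral_indicator_const _ (hm i), smul_eq_mul, mul_one]
    exact hone i
  have hset : {e : Fin n → Labelled | n * ε / 8 ≤ ((Finset.univ.filter fun i =>
        (e i).1.1 = true ∧ t < rankDiff (fun j => select (e j)) i).card : ℝ)}
      = {e | n * ε / 8 ≤ ∑ i : Fin n, {e : Fin n → Labelled |
        (e i).1.1 = true ∧ t < rankDiff (fun j => select (e j)) i}.indicator
          (fun _ => (1 : ℝ)) e} := by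
    ext e
    rw [Set.mem_ofPred_eq, Set.mem_ofPred_eq, ← Finset.sum_boole]
    refine iff_of_eq (congrArg _ (Finset.sum_congr rfl fun i _ => ?_))
    by_cases hi : (e i).1.1 = true ∧ t < rankDiff (fun j => select (e j)) i
    · rw [if_pos hi]
      exact (Set.indicator_of_mem (s := {e : Fin n → Labelled |
        (e i).1.1 = true ∧ t < rankDiff (fun j => select (e j)) i}) hi fun _ => (1 : ℝ)).symm
    · rw [if_neg hi]
      exact (Set.indicator_of_notMem (s := {e : Fin n → Labelled |
        (e i).1.1 = true ∧ t < rankDiff (fun j => select (e j)) i}) hi fun _ => (1 : ℝ)).symm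
  rw [hset]
  have hnε : 0 < n * ε := by positivity
  refine le_of_mul_le_mul_left ((hmk.trans hsum).trans_eq ?_) (show 0 < n * ε / 8 by positivity)
  rw [hδ]
  ring

/-- Termwise, a contaminated observation is either near or far, and a clean one is counted only when
near. -/
lemma contaminatedCard_le {n : ℕ} (t : ℕ) (e : Fin n → Labelled) :
    (contaminatedCard e : ℝ) + cleanCount t e
      ≤ ((Finset.univ.filter fun i => rankDiff (fun j => select (e j)) i ≤ t).card : ℝ)
        + ((Finset.univ.filter fun i =>
          (e i).1.1 = true ∧ t < rankDiff (fun j => select (e j)) i).card : ℝ) := by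
  rw [contaminatedCard, cleanCount, ← Finset.sum_boole, ← Finset.sum_boole, ← Finset.sum_boole,
    ← Finset.sum_add_distrib, ← Finset.sum_add_distrib]
  refine Finset.sum_le_sum fun i _ => ?_
  have hnear : near t (rank (fun j => (select (e j)).1) i) (rank (fun j => (select (e j)).2) i)
      = if rankDiff (fun j => select (e j)) i ≤ t then 1 else 0 := rfl
  rw [hnear]
  by_cases h1 : (e i).1.1 = true <;> by_cases h2 : rankDiff (fun j => select (e j)) i ≤ t
  · simp only [h1, h2, not_lt.2 h2]
    norm_num
  · simp only [h1, h2, not_le.1 h2]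
    norm_num
  · simp [h1, h2]
  · simp [h1, h2]

/-- A bound for the probability that the statistic is small under the alternative. -/
lemma real_hcRank_le_alternative {n t : ℕ} (hn : 4 ≤ n) (ht : t ≤ n / 2)
    (ht' : 96 * (2 * (t : ℝ) + 1) ≤ n) {ε ρ : ℝ} (h0 : 0 < ε) (h1 : ε ≤ 1 / 3)
    (hρ0 : 0 ≤ ρ) (hρ1 : ρ ≤ 1) {L : ℝ} (hL : L < n * ε / 4 / √(2 * t + 1)) :
    (Measure.pi fun _ : Fin n => pairMixture ε (gaussianPair ρ)).real {s | hcRank s ≤ L}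
      ≤ 4 / (n * ε) + 8 * (n + 2 * n ^ 2 * (1 - ρ)) / (t + 1) ^ 2
        + 4 * (2 * t + 1) / (n * ε / 16) ^ 2 := by
  have hε1 : ε ≤ 1 := by linarith
  have hn0 : (0 : ℝ) < n := by positivity
  have hnε : 0 < n * ε := by positivity
  have := isProbabilityMeasure_labelledLaw h0.le hε1 (gaussianPair ρ)
  have := isProbabilityMeasure_pairMixture h0.le hε1 (gaussianPair ρ)
  have hsel : MeasurePreserving select (labelledLaw ε (gaussianPair ρ))
      (pairMixture ε (gaussianPair ρ)) := ⟨measurable_select, map_select_labelledLaw ε _⟩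
  have hMP := measurePreserving_pi (fun _ : Fin n => labelledLaw ε (gaussianPair ρ))
    (fun _ => pairMixture ε (gaussianPair ρ)) fun _ => hsel
  have hset : MeasurableSet {s : Fin n → ℝ × ℝ | hcRank s ≤ L} :=
    measurableSet_le measurable_hcRank measurable_const
  rw [← hMP.measureReal_preimage hset.nullMeasurableSet]
  set E₁ := {e : Fin n → Labelled | n * ε / 2 ≤ |(contaminatedCard e : ℝ) - n * ε|}
  set E₂ := {e : Fin n → Labelled | n * ε / 8 ≤ ((Finset.univ.filter fun i =>
        (e i).1.1 = true ∧ t < rankDiff (fun j => select (e j)) i).card : ℝ)}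
  set E₃ := {e : Fin n → Labelled | 2 * contaminatedCard e ≤ n ∧ cleanCount t e
    ≤ n * nullProb n t - contaminatedCard e * (4 * (2 * t + 1) / n) - n * ε / 16}
  have hsub : (fun (e : Fin n → Labelled) i => select (e i)) ⁻¹' {s | hcRank s ≤ L}
      ⊆ (E₁ ∪ E₂) ∪ E₃ := by
    intro e he
    by_contra hcon
    simp only [Set.mem_union, not_or] at hcon
    obtain ⟨⟨he1, he2⟩, he3⟩ := hcon
    replace he1 := abs_lt.1 (not_le.1
      (show ¬ n * ε / 2 ≤ |(contaminatedCard e : ℝ) - n * ε| from he1))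
    replace he2 := not_le.1 (show ¬ n * ε / 8 ≤ ((Finset.univ.filter fun i =>
      (e i).1.1 = true ∧ t < rankDiff (fun j => select (e j)) i).card : ℝ) from he2)
    have hK : 2 * contaminatedCard e ≤ n := by
      have : 2 * (contaminatedCard e : ℝ) ≤ n := by nlinarith
      exact_mod_cast this
    have he3' := not_le.1 fun h => he3 ⟨hK, h⟩
    have hcount := contaminatedCard_le t e
    -- At most `3nε/2` contaminated observations, times `1/24`. In units of `n ε` the excess of the
    -- count over `n u(t)` is then at least `1/2 - 1/8 - 1/16 - 1/16 = 1/4`.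
    have hloss : (contaminatedCard e : ℝ) * (4 * (2 * t + 1) / n) ≤ n * ε / 16 := by
      have h2 : 4 * (2 * (t : ℝ) + 1) / n ≤ 1 / 24 := by
        rw [div_le_div_iff₀ hn0 (by norm_num)]
        linarith
      have h3 : (contaminatedCard e : ℝ) * (4 * (2 * t + 1) / n) ≤ contaminatedCard e * (1 / 24) :=
        mul_le_mul_of_nonneg_left h2 (Nat.cast_nonneg _)
      linarith
    obtain ⟨hu1, hu2, hu3, hu4⟩ := nullProb_bounds hn ht
    have hle := le_hcRank (fun i => select (e i)) ht
    have hstd : n * ε / 4 / √(2 * t + 1) ≤ standardizedCount (fun i => select (e i)) t := by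
      have hv : 0 < n * nullProb n t * (1 - nullProb n t) := mul_pos (by linarith) (by linarith)
      rw [standardizedCount]
      refine div_le_div₀ (by linarith) (by linarith) (Real.sqrt_pos.2 hv) (Real.sqrt_le_sqrt ?_)
      nlinarith
    exact absurd (hL.trans_le (hstd.trans hle)) (not_lt.2 he)
  refine (measureReal_mono hsub (measure_ne_top _ _)).trans ((measureReal_union_le _ _).trans
    (add_le_add ((measureReal_union_le _ _).trans (add_le_add ?_ ?_)) ?_))
  · exact real_contaminatedCard_le n h0 hε1 (by omega) _
  · exact real_contaminated_far_le (by omega) t h0 hε1 hρ0 hρ1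
  · exact real_cleanCount_le hn ht h0.le hε1 (measurePreserving_fst_gaussianPair hρ0 hρ1)
      (measurePreserving_snd_gaussianPair hρ0 hρ1) (by positivity)

/-! ### Asymptotics in `n` and the choice of the threshold. -/

lemma tendsto_const_mul_rpow_of_neg (c : ℝ) {a : ℝ} (ha : a < 0) :
    Tendsto (fun n : ℕ => c * (n : ℝ) ^ a) atTop (𝓝 0) := by
  have h := ((tendsto_rpow_neg_atTop (neg_pos.2 ha)).comp tendsto_natCast_atTop_atTop).const_mul c
  simpa using h

/-- Under the alternative, the statistic exceeds every multiple of `log n`. -/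
theorem tendsto_real_hcRank_le_alternative {β γ : ℝ} (hβ : 1 / 2 < β) (hβ' : β < 3 / 4)
    (hγ : 4 * (β - 1 / 2) < γ) {F G : ℕ → ℝ → ℝ} {Q : ℕ → Measure (ℝ × ℝ)}
    (h : ∀ᶠ n : ℕ in atTop, IsGaussianMixtureCopula (F n) (G n)
      ((n : ℝ) ^ (-β)) (1 - (n : ℝ) ^ (-γ)) (Q n)) (M : ℝ) :
    Tendsto (fun n : ℕ => (sampleLaw n (Q n)).real {s | hcRank s ≤ M * Real.log n})
      atTop (𝓝 0) := by
  -- The exponent of the threshold `t ≈ n^a`: above `1/2` to dominate the sampling noise of the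
  -- ranks, above `1 - γ/2` to dominate the latent discrepancy, below `2 - 2β` so that `√t` is
  -- negligible against `n ε = n^(1 - β)`.
  obtain ⟨a, ha1, ha2⟩ : ∃ a, max (1 / 2) (1 - γ / 2) < a ∧ a < 2 - 2 * β :=
    exists_between (max_lt (by linarith) (by linarith))
  obtain ⟨ha1, ha3⟩ := max_lt_iff.1 ha1
  have hlim : Tendsto (fun n : ℕ => 4 * (n : ℝ) ^ (β - 1) + (8 * (n : ℝ) ^ (1 - 2 * a)
      + 16 * (n : ℝ) ^ (2 - γ - 2 * a)) + 3072 * (n : ℝ) ^ (a + 2 * β - 2)) atTop (𝓝 0) := by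
    have := ((tendsto_const_mul_rpow_of_neg 4 (show β - 1 < 0 by linarith)).add
      ((tendsto_const_mul_rpow_of_neg 8 (show 1 - 2 * a < 0 by linarith)).add
      (tendsto_const_mul_rpow_of_neg 16 (show 2 - γ - 2 * a < 0 by linarith)))).add
      (tendsto_const_mul_rpow_of_neg 3072 (show a + 2 * β - 2 < 0 by linarith))
    simpa using this
  refine squeeze_zero' (Eventually.of_forall fun _ => measureReal_nonneg) ?_ hlim
  -- Since `2t + 1 ≤ 3 n^a`, this secures `96 (2t + 1) ≤ n`. The same estimate explains `3072 = 4 ·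
  -- 3 · 16²` in the limit above.
  have hev1 : ∀ᶠ n : ℕ in atTop, (n : ℝ) ^ (a - 1) < 1 / 288 := by
    have := tendsto_const_mul_rpow_of_neg 1 (show a - 1 < 0 by linarith)
    simp only [one_mul] at this
    exact this.eventually_lt_const (by norm_num)
  have hev2 : ∀ᶠ n : ℕ in atTop, (n : ℝ) ^ (-β) < 1 / 3 := by
    have := tendsto_const_mul_rpow_of_neg 1 (show -β < 0 by linarith)
    simp only [one_mul] at this
    exact this.eventually_lt_const (by norm_num)
  -- The factor `8` collects the `4` in `n ε / 4` and the `2` in `√(2t + 1) ≤ 2 n^(a/2)`.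
  have hev3 : ∀ᶠ n : ℕ in atTop, 8 * |M| * Real.log n < (n : ℝ) ^ (1 - β - a / 2) := by
    have ho := ((isLittleO_log_rpow_atTop (show 0 < 1 - β - a / 2 by linarith)).comp_tendsto
      tendsto_natCast_atTop_atTop).const_mul_left (8 * |M|)
    have := ho.bound (show (0 : ℝ) < 1 / 2 by norm_num)
    filter_upwards [this, eventually_gt_atTop 0] with n hn hn0
    have hpos : 0 < (n : ℝ) ^ (1 - β - a / 2) := Real.rpow_pos_of_pos (by positivity) _
    simp only [Function.comp_apply, Real.norm_eq_abs] at hn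
    rw [abs_of_pos hpos] at hn
    linarith [le_abs_self (8 * |M| * Real.log n)]
  filter_upwards [h, hev1, hev2, hev3, eventually_ge_atTop 4] with n hn hn1 hn2 hn3 hn4
  have hn0 : (0 : ℝ) < n := by positivity
  have hn1' : (1 : ℝ) ≤ n := by
    have : 1 ≤ n := by omega
    exact_mod_cast this
  set t := ⌊(n : ℝ) ^ a⌋₊ with ht
  have hna : 1 ≤ (n : ℝ) ^ a := Real.one_le_rpow hn1' (by linarith)
  have ht1 : (t : ℝ) ≤ (n : ℝ) ^ a := Nat.floor_le (by linarith)
  have ht2 : (n : ℝ) ^ a < t + 1 := Nat.lt_floor_add_one _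
  have hnal : (n : ℝ) ^ a * 288 ≤ n := by
    have e : (n : ℝ) ^ a = n ^ (a - 1) * n := by
      rw [← Real.rpow_add_one hn0.ne']
      ring_nf
    rw [e]
    nlinarith
  have ht3 : t ≤ n / 2 := by
    rw [Nat.le_div_iff_mul_le two_pos]
    have : (t : ℝ) * 2 ≤ n := by linarith
    exact_mod_cast this
  have hε0 : 0 < (n : ℝ) ^ (-β) := Real.rpow_pos_of_pos hn0 _
  have hnε : n * (n : ℝ) ^ (-β) = n ^ (1 - β) := by
    rw [mul_comm, ← Real.rpow_add_one hn0.ne']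
    ring_nf
  have hL : M * Real.log n < n * (n : ℝ) ^ (-β) / 4 / √(2 * t + 1) := by
    have hs : √(2 * (t : ℝ) + 1) ≤ 2 * (n : ℝ) ^ (a / 2) := by
      refine Real.sqrt_le_iff.2 ⟨by positivity, ?_⟩
      rw [mul_pow, ← Real.rpow_natCast ((n : ℝ) ^ (a / 2)), ← Real.rpow_mul hn0.le]
      push_cast
      rw [div_mul_cancel₀ _ two_ne_zero]
      linarith
    have hspos : 0 < √(2 * (t : ℝ) + 1) := Real.sqrt_pos.2 (by positivity)
    rw [hnε, lt_div_iff₀ hspos]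
    have hlog := Real.log_natCast_nonneg n
    have h2 : M * Real.log n * √(2 * (t : ℝ) + 1)
        ≤ |M| * Real.log n * (2 * (n : ℝ) ^ (a / 2)) := by
      have := le_abs_self M
      gcongr
    refine h2.trans_lt ?_
    have e : (n : ℝ) ^ (1 - β) = n ^ (1 - β - a / 2) * n ^ (a / 2) := by
      rw [← Real.rpow_add hn0]
      ring_nf
    rw [e]
    have hp : 0 < (n : ℝ) ^ (a / 2) := Real.rpow_pos_of_pos hn0 _
    nlinarith
  have e := real_sampleLaw_hcRank hn (n := n) (measurableSet_Iic (a := M * Real.log n))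
  refine e.trans_le ((real_hcRank_le_alternative hn4 ht3 (by linarith) hε0 hn2.le hn.corr_nonneg
    hn.corr_le hL).trans ?_)
  refine add_le_add (add_le_add ?_ ?_) ?_
  · rw [hnε, div_eq_mul_inv, ← Real.rpow_neg hn0.le, neg_sub]
  · have h1 : 8 * (n + 2 * (n : ℝ) ^ 2 * (1 - (1 - (n : ℝ) ^ (-γ)))) / ((t : ℝ) + 1) ^ 2
        ≤ 8 * (n + 2 * (n : ℝ) ^ 2 * (n : ℝ) ^ (-γ)) / ((n : ℝ) ^ a) ^ 2 := by
      rw [sub_sub_cancel]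
      have : 0 < (n : ℝ) ^ (-γ) := Real.rpow_pos_of_pos hn0 _
      gcongr
    refine h1.trans_eq ?_
    rw [Real.rpow_sub hn0, Real.rpow_sub hn0, Real.rpow_sub hn0, Real.rpow_one, mul_comm 2 a,
      Real.rpow_mul hn0.le, Real.rpow_neg hn0.le]
    simp only [Real.rpow_two]
    field_simp
    ring
  · have e2 : (n : ℝ) ^ (a + 2 * β - 2) = n ^ a / ((n : ℝ) ^ (1 - β)) ^ 2 := by
      rw [← Real.rpow_two, ← Real.rpow_mul hn0.le, ← Real.rpow_sub hn0]
      ring_nf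
    rw [hnε, e2, div_pow, div_div_eq_mul_div, mul_div_assoc']
    refine div_le_div_of_nonneg_right ?_ (by positivity)
    linarith

end RankHC

end

theorem theorem2 :
    (∃ C : ℝ, 0 < C ∧
      -- under the null, the statistic is at most `C log n` with probability tending to one
      (∀ (F G : ℕ → ℝ → ℝ) (ρ : ℕ → ℝ) (Q : ℕ → Measure (ℝ × ℝ)),
        (∀ᶠ n in atTop, RankHC.IsGaussianMixtureCopula (F n) (G n) 0 (ρ n) (Q n)) →
        Tendsto (fun n : ℕ => (RankHC.sampleLaw n (Q n)).real
          {s | C * Real.log n ≤ RankHC.hcRank s}) atTop (𝓝 0)) ∧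
      -- the test that rejects when the statistic is at least `C log n` is powerful
      (∀ β γ : ℝ, 1 / 2 < β → β < 3 / 4 → 4 * (β - 1 / 2) < γ →
        ∀ (F₀ G₀ F₁ G₁ : ℕ → ℝ → ℝ) (ρ₀ : ℕ → ℝ) (Q₀ Q₁ : ℕ → Measure (ℝ × ℝ)),
        (∀ᶠ n in atTop, RankHC.IsGaussianMixtureCopula (F₀ n) (G₀ n) 0 (ρ₀ n) (Q₀ n)) →
        (∀ᶠ n : ℕ in atTop, RankHC.IsGaussianMixtureCopula (F₁ n) (G₁ n)
          ((n : ℝ) ^ (-β)) (1 - (n : ℝ) ^ (-γ)) (Q₁ n)) →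
        RankHC.AsymptoticallyPowerful
          (fun n => RankHC.sampleLaw n (Q₀ n)) (fun n => RankHC.sampleLaw n (Q₁ n))
          (fun n => {s | C * Real.log n ≤ RankHC.hcRank s}))) ∧
    -- under the alternative, the statistic exceeds every multiple of `log n`
    (∀ β γ : ℝ, 1 / 2 < β → β < 3 / 4 → 4 * (β - 1 / 2) < γ →
      ∀ (F G : ℕ → ℝ → ℝ) (Q : ℕ → Measure (ℝ × ℝ)),
      (∀ᶠ n : ℕ in atTop, RankHC.IsGaussianMixtureCopula (F n) (G n)
        ((n : ℝ) ^ (-β)) (1 - (n : ℝ) ^ (-γ)) (Q n)) →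
      ∀ M : ℝ, Tendsto (fun n : ℕ => (RankHC.sampleLaw n (Q n)).real
        {s | M * Real.log n < RankHC.hcRank s}) atTop (𝓝 1)) := by
  refine ⟨⟨24, by norm_num, fun F G ρ Q h => RankHC.tendsto_real_le_hcRank_null h,
    fun β γ hβ hβ' hγ F₀ G₀ F₁ G₁ ρ₀ Q₀ Q₁ h₀ h₁ => ?_⟩, fun β γ hβ hβ' hγ F G Q h M => ?_⟩
  · have hI := RankHC.tendsto_real_le_hcRank_null h₀
    -- Divergence beyond every multiple of `log n` allows the critical constant of the null to be
    -- reused here.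
    have hII := RankHC.tendsto_real_hcRank_le_alternative hβ hβ' hγ h₁ 24
    have hsum := hI.add hII
    rw [add_zero] at hsum
    refine squeeze_zero' (Eventually.of_forall fun n =>
      add_nonneg measureReal_nonneg measureReal_nonneg) ?_ hsum
    filter_upwards [h₁] with n hn
    have := hn.isProbabilityMeasure_sampleLaw n
    have hsub : {s : Fin n → ℝ × ℝ | 24 * Real.log n ≤ RankHC.hcRank s}ᶜ
        ⊆ {s | RankHC.hcRank s ≤ 24 * Real.log n} := fun s hs =>
      (not_le.1 (show ¬ 24 * Real.log n ≤ RankHC.hcRank s from hs)).le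
    exact add_le_add_right (measureReal_mono hsub (measure_ne_top _ _)) _
  · have hlim := (RankHC.tendsto_real_hcRank_le_alternative hβ hβ' hγ h M).const_sub 1
    rw [sub_zero] at hlim
    refine hlim.congr' ?_
    filter_upwards [h] with n hn
    have := hn.isProbabilityMeasure_sampleLaw n
    rw [← probReal_compl_eq_one_sub (measurableSet_le RankHC.measurable_hcRank measurable_const)]
    congr 1
    ext s
    simp
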